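/- Let $H$ be a Hopf algebra over a field $k$ (its antipode need not be bijective), and let $A$ be a right $H$-comodule algebra, i.e. an associative unital $k$-algebra with a right $H$-comodule structure $\rho_A:A\to A\otimes_k H$ that is a homomorphism of algebras. Let ${}_A\mathcal M^H$ (respectively $\mathcal M_A^H$) be the category of left (respectively right) $A$-modules $M$ with a right $H$-comodule structure $\rho_M:M\to M\otimes_k H$ such that $\rho_M(am)=\rho_A(a)\rho_M(m)$ (respectively $\rho_M(ma)=\rho_M(m)\rho_A(a)$) for all $a\in A$, $m\in M$. Assume that $A$ is a simple object of ${}_A\mathcal M^H$, i.e. $A\neq 0$ and $A$ has no nonzero proper left ideal $I$ with $\rho_A(I)\subseteq I\otimes_k H$. Suppose that (1) $A$ has a von Neumann regular two-sided classical quotient ring $Q(A)$, i.e. $A$ is a subring of a von Neumann regular ring $Q(A)$ in which all nonzerodivisors of $A$ (elements that are neither left nor right zero divisors) are invertible, and for each $x\in Q(A)$ there are nonzerodivisors $s,t\in A$ with $sx\in A$ and $xt\in A$; (2) $A$ is right coherent, i.e. each finitely generated right ideal of $A$ is a finitely presented right $A$-module; (3) each finitely presented right $A$-module has finite projective dimension.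 Then all objects of $\mathcal M_A^H$ are flat right $A$-modules. If moreover there exists a ring homomorphism $A\to R$ for some nonzero right Artinian ring $R$, then all objects of $\mathcal M_A^H$ are projective right $A$-modules. -/

import Mathlib

open scoped TensorProduct

/-! Right modules over a ring `A` are modules over `Aᵐᵒᵖ`; thus `MulOpposite.op a • m` is `m a`. -/

section Comodules

variable {k H : Type*} [Field k] [Ring H] [HopfAlgebra k H]

/-- `ρ : M → M ⊗ H` is a right `H`-comodule structure: it is coassociative and counital. -/
structure IsRightCoaction {M : Type*} [AddCommGroup M] [Module k M]
    (ρ : M →ₗ[k] M ⊗[k] H) : Prop where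
  coassoc : (TensorProduct.assoc k M H H).toLinearMap ∘ₗ ρ.rTensor H ∘ₗ ρ =
    (Coalgebra.comul (R := k) (A := H)).lTensor M ∘ₗ ρ
  counit : (TensorProduct.rid k M).toLinearMap ∘ₗ
    (Coalgebra.counit (R := k) (A := H)).lTensor M ∘ₗ ρ = LinearMap.id

/-- The `k`-subspace `U` of `M` is an `H`-subcomodule: `ρ(U) ⊆ U ⊗ H`, where `U ⊗ H` is identified
with its image in `M ⊗ H`. -/
def IsSubcomodule {M : Type*} [AddCommGroup M] [Module k M]
    (ρ : M →ₗ[k] M ⊗[k] H) (U : Submodule k M) : Prop :=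
  ∀ u ∈ U, ρ u ∈ LinearMap.range (U.subtype.rTensor H)

variable {A : Type*} [Ring A] [Algebra k A]

/-- `ρA : A → A ⊗ H` makes `A` a right `H`-comodule algebra: it is a right `H`-comodule structure
which is a homomorphism of algebras. -/
def IsRightComoduleAlgebra (ρA : A →ₐ[k] A ⊗[k] H) : Prop :=
  IsRightCoaction ρA.toLinearMap

section Left

variable {M : Type*} [AddCommGroup M] [Module k M] [Module A M] [IsScalarTower k A M]

/-- The left action of `A ⊗ H` on `M ⊗ H`: `(a ⊗ g)(m ⊗ h) = a m ⊗ g h`. -/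
noncomputable def leftTensorAct : A ⊗[k] H →ₗ[k] M ⊗[k] H →ₗ[k] M ⊗[k] H :=
  TensorProduct.map₂ (Algebra.lsmul k k M).toLinearMap (LinearMap.mul k H)

/-- `M` is an object of the category `_A M^H` with coaction `ρM`: a left `A`-module and a right
`H`-comodule such that `ρ(a m) = ∑ a₀ m₀ ⊗ a₁ m₁`. -/
structure IsLeftHopfModule (ρA : A →ₐ[k] A ⊗[k] H) (ρM : M →ₗ[k] M ⊗[k] H) : Prop where
  coaction : IsRightCoaction ρM
  smul : ∀ (a : A) (m : M), ρM (a • m) = leftTensorAct (ρA a) (ρM m)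

/-- `M`, with coaction `ρM`, is a simple object of the category `_A M^H`: it is a nonzero object
whose only subobjects (`A`-submodules that are `H`-subcomodules) are `0` and `M`. -/
structure IsSimpleLeftHopfModule (ρA : A →ₐ[k] A ⊗[k] H) (ρM : M →ₗ[k] M ⊗[k] H) : Prop where
  isLeftHopfModule : IsLeftHopfModule ρA ρM
  nontrivial : Nontrivial M
  eq_bot_or_eq_top : ∀ N : Submodule A M,
    IsSubcomodule ρM (N.restrictScalars k) → N = ⊥ ∨ N = ⊤

end Left

section Right

variable {M : Type*} [AddCommGroup M] [Module k M] [Module Aᵐᵒᵖ M] [IsScalarTower k Aᵐᵒᵖ M]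

/-- The right action of `A` on `M` as a bilinear map `(m, a) ↦ m a`. -/
def rightActBilin : M →ₗ[k] A →ₗ[k] M :=
  LinearMap.mk₂ k (fun m a => MulOpposite.op a • m)
    (fun m n a => smul_add _ m n)
    (fun c m a => smul_comm _ c m)
    (fun m a b => by simp [add_smul])
    (fun c m a => by simp [smul_assoc])

/-- The right action of `A ⊗ H` on `M ⊗ H`: `(m ⊗ h)(a ⊗ g) = m a ⊗ h g`. -/
noncomputable def rightTensorAct : M ⊗[k] H →ₗ[k] A ⊗[k] H →ₗ[k] M ⊗[k] H :=
  TensorProduct.map₂ rightActBilin (LinearMap.mul k H)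

/-- `M` is an object of the category `M_A^H` with coaction `ρM`: a right `A`-module and a right
`H`-comodule such that `ρ(m a) = ∑ m₀ a₀ ⊗ m₁ a₁`. -/
structure IsRightHopfModule (ρA : A →ₐ[k] A ⊗[k] H) (ρM : M →ₗ[k] M ⊗[k] H) : Prop where
  coaction : IsRightCoaction ρM
  smul : ∀ (m : M) (a : A), ρM (MulOpposite.op a • m) = rightTensorAct (ρM m) (ρA a)

end Right

end Comodules

section Rings

/-- A ring is von Neumann regular if each `x` satisfies `x = x y x` for some `y`. -/
def IsVonNeumannRegularRing (R : Type*) [Ring R] : Prop :=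
  ∀ x : R, ∃ y : R, x * y * x = x

/-- The embedding `ι : A → Q` makes `Q` a two-sided classical quotient ring of `A`. Here
`nonZeroDivisors A` consists of the elements that are neither left nor right zero divisors. -/
structure IsClassicalQuotientRing {A Q : Type*} [Ring A] [Ring Q] (ι : A →+* Q) : Prop where
  injective : Function.Injective ι
  isUnit : ∀ s ∈ nonZeroDivisors A, IsUnit (ι s)
  left_fraction : ∀ x : Q, ∃ s ∈ nonZeroDivisors A, ∃ a : A, ι s * x = ι a
  right_fraction : ∀ x : Q, ∃ s ∈ nonZeroDivisors A, ∃ a : A, x * ι s = ι a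

/-- A ring is right coherent if each finitely generated right ideal is a finitely presented
right module. -/
def IsRightCoherentRing (A : Type*) [Ring A] : Prop :=
  ∀ I : Submodule Aᵐᵒᵖ A, I.FG → Module.FinitePresentation Aᵐᵒᵖ I

end Rings

universe uk uH uA uQ uM uN uR

section Flat

variable (A : Type uA) [Ring A] (M : Type uM) [AddCommGroup M] [Module Aᵐᵒᵖ M]

/-- The subgroup of `M ⊗_ℤ N` generated by the elements `m a ⊗ n - m ⊗ a n`. -/
def balancedRelations (N : Type*) [AddCommGroup N] [Module A N] : AddSubgroup (M ⊗[ℤ] N) :=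
  AddSubgroup.closure {x | ∃ (m : M) (a : A) (n : N),
    x = (MulOpposite.op a • m) ⊗ₜ[ℤ] n - m ⊗ₜ[ℤ] (a • n)}

/-- The tensor product `M ⊗_A N` of a right `A`-module `M` and a left `A`-module `N`. -/
abbrev BalancedTensor (N : Type*) [AddCommGroup N] [Module A N] : Type _ :=
  (M ⊗[ℤ] N) ⧸ balancedRelations A M N

/-- The map `M ⊗_A N → M ⊗_A N'` induced by an `A`-linear map `N → N'`. -/
def balancedTensorMap {N N' : Type*} [AddCommGroup N] [Module A N] [AddCommGroup N'] [Module A N']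
    (f : N →ₗ[A] N') : BalancedTensor A M N →+ BalancedTensor A M N' :=
  QuotientAddGroup.map _ _ (f.toAddMonoidHom.toIntLinearMap.lTensor M).toAddMonoidHom <| by
    refine (AddSubgroup.closure_le _).2 ?_
    rintro _ ⟨m, a, n, rfl⟩
    exact AddSubgroup.subset_closure ⟨m, a, f n, by simp⟩

/-- The right `A`-module `M` is flat: `M ⊗_A -` preserves injectivity of homomorphisms of left
`A`-modules (living in an arbitrary universe `uN`). -/
def IsRightFlat : Prop :=
  ∀ (N N' : Type uN) [AddCommGroup N] [Module A N] [AddCommGroup N'] [Module A N']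
    (f : N →ₗ[A] N'), Function.Injective f → Function.Injective (balancedTensorMap A M f)

end Flat

/-!
Write `F` for a free right module `A ^ n` of columns whose standard basis spans a comodule with
coefficient matrix `h`; such an `F` is a Hopf module, and every finite subset of a Hopf module `M`
lies in the image of a Hopf module homomorphism `F → M`, because comodules are locally finite. The
whole argument takes place inside these modules `F` and their duals `Hom_A(F, A)`, the left
modules of rows, on which the coaction involves the antipode (only the antipode itself, never its
inverse). A Hopf submodule of `F` is recognized by its slices `(id ⊗ χ)(ρ(x))`, with `χ` a linear
functional on `H`.

The key fact is `projective_quotient_of_fg`: for a finitely generated Hopf submodule `K` of `F`,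
the module `F / K` is projective. Choose a free Hopf module `F'` mapping onto `K`. By coherence
the kernel of `F' → K` is finitely generated, and the projective dimension of `K ≅ F' / ker` is
smaller than that of `F / K` unless the latter is projective, so `K` is projective by induction.
It remains to see that `Ext¹(F / K, A) = 0`, i.e. that every functional on `K` extends to `F`
(`rowAnnihilator_le_rowRange`). Over the von Neumann regular ring `Q(A)` this is so since matrices
have generalized inverses. Hence a nonzerodivisor of `A` multiplies any finite set of functionals
on `K` into the module `L` of those that extend. If the functionals span a subcomodule, the
elements of `A` with this property form a left ideal stable under the coaction
(`isSubcomodule_conductor`); it is nonzero, so by simplicity it contains `1`.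

Flatness follows because every Hopf module is a directed colimit of modules `F / K` as above
(`IsRightHopfModule.isRightFlat`). If there is a homomorphism from `A` to a right Artinian ring
`R ≠ 0`, which is right Noetherian by the Hopkins–Levitzki theorem, then every Hopf submodule of
`F` is finitely generated (`fg_of_isSubcomodule`): two nested finitely generated Hopf submodules
with the same image in `R ^ n` coincide, for otherwise the functionals vanishing on the smaller
one take values on the larger one which generate a stable left ideal, so generate `A`, yet vanish
in `R`. Therefore every finitely generated Hopf module is projective, and Zorn's lemma extends
this to all Hopf modules (`IsRightHopfModule.projective`).
-/

/-! ### Slices of tensors and subcomodules -/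

section Slices

variable {k H : Type*} [Field k] [Ring H] [HopfAlgebra k H]
variable {M M' : Type*} [AddCommGroup M] [Module k M] [AddCommGroup M'] [Module k M']

/-- The slice map `id ⊗ χ : M ⊗ H → M` of a linear functional `χ` on `H`. -/
noncomputable def slice (χ : Module.Dual k H) : M ⊗[k] H →ₗ[k] M :=
  (TensorProduct.rid k M).toLinearMap ∘ₗ χ.lTensor M

@[simp]
theorem slice_tmul (χ : Module.Dual k H) (m : M) (h : H) :
    slice χ (m ⊗ₜ[k] h) = χ h • m := by
  simp [slice]

theorem slice_rTensor (χ : Module.Dual k H) (T : M →ₗ[k] M') (t : M ⊗[k] H) :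
    slice χ (T.rTensor H t) = T (slice χ t) := by
  induction t with
  | zero => simp
  | tmul m h => simp
  | add x y hx hy => simp only [map_add, hx, hy]

/-- Over a field, a tensor is determined by its slices. -/
theorem eq_of_slice_eq {t t' : M ⊗[k] H} (h : ∀ χ : Module.Dual k H, slice χ t = slice χ t') :
    t = t' := by
  classical
  let b := Module.Basis.ofVectorSpace k H
  have key : ∀ (t : M ⊗[k] H) i,
      TensorProduct.equivFinsuppOfBasisRight (M := M) b t i = slice (b.coord i) t := by
    intro t i
    induction t with
    | zero => simp
    | tmul m h => simp
    | add x y hx hy => simp only [map_add, Finsupp.add_apply, hx, hy]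
  apply (TensorProduct.equivFinsuppOfBasisRight (M := M) b).injective
  ext i
  rw [key, key, h]

theorem mem_range_rTensor_iff_slice (U : Submodule k M) (t : M ⊗[k] H) :
    t ∈ LinearMap.range (U.subtype.rTensor H) ↔ ∀ χ : Module.Dual k H, slice χ t ∈ U := by
  constructor
  · rintro ⟨t, rfl⟩ χ
    rw [slice_rTensor]
    exact (slice χ t).2
  · intro h
    obtain ⟨g, hg⟩ := LinearMap.exists_leftInverse_of_injective U.subtype U.ker_subtype
    refine ⟨g.rTensor H t, eq_of_slice_eq fun χ => ?_⟩
    rw [slice_rTensor, slice_rTensor]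
    have := LinearMap.congr_fun hg ⟨_, h χ⟩
    exact congrArg Subtype.val this

theorem isSubcomodule_iff_slice {ρ : M →ₗ[k] M ⊗[k] H} {U : Submodule k M} :
    IsSubcomodule ρ U ↔ ∀ u ∈ U, ∀ χ : Module.Dual k H, slice χ (ρ u) ∈ U := by
  simp only [IsSubcomodule, mem_range_rTensor_iff_slice]

theorem exists_fg_slice_mem (t : M ⊗[k] H) :
    ∃ D : Submodule k M, D.FG ∧ ∀ χ : Module.Dual k H, slice χ t ∈ D := by
  induction t with
  | zero => exact ⟨⊥, Submodule.fg_bot, by simp⟩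
  | tmul m h =>
    refine ⟨k ∙ m, Submodule.fg_span_singleton m, fun χ => ?_⟩
    rw [slice_tmul]
    exact Submodule.smul_mem _ _ (Submodule.mem_span_singleton_self m)
  | add x y hx hy =>
    obtain ⟨D, hD, h⟩ := hx
    obtain ⟨E, hE, h'⟩ := hy
    refine ⟨D ⊔ E, hD.sup hE, fun χ => ?_⟩
    rw [map_add]
    exact Submodule.add_mem_sup (h χ) (h' χ)

/-- Coassociativity, read on slices: slicing twice is slicing along the convolution product. -/
theorem IsRightCoaction.slice_slice {ρ : M →ₗ[k] M ⊗[k] H} (hρ : IsRightCoaction ρ)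
    (χ ψ : Module.Dual k H) (m : M) :
    slice ψ (ρ (slice χ (ρ m))) =
      slice (LinearMap.mul' k k ∘ₗ TensorProduct.map ψ χ ∘ₗ Coalgebra.comul) (ρ m) := by
  have h := LinearMap.congr_fun hρ.coassoc m
  simp only [LinearMap.comp_apply, LinearEquiv.coe_coe] at h
  have h1 : ∀ t : M ⊗[k] H, slice ψ (ρ (slice χ t)) =
      slice (LinearMap.mul' k k ∘ₗ TensorProduct.map ψ χ)
        (TensorProduct.assoc k M H H (ρ.rTensor H t)) := by
    intro t
    induction t with
    | zero => simp
    | tmul m h =>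
      simp only [slice_tmul, LinearMap.rTensor_tmul, map_smul]
      induction ρ m with
      | zero => simp
      | tmul m g => simp [smul_smul, mul_comm]
      | add x y hx hy => simp only [map_add, smul_add, TensorProduct.add_tmul, hx, hy]
    | add x y hx hy => simp only [map_add, hx, hy]
  rw [h1, h]
  induction ρ m with
  | zero => simp
  | tmul m g => simp [slice]
  | add x y hx hy => simp only [map_add, hx, hy]

theorem IsRightCoaction.slice_counit {ρ : M →ₗ[k] M ⊗[k] H} (hρ : IsRightCoaction ρ) (m : M) :
    slice (Coalgebra.counit (R := k) (A := H)) (ρ m) = m :=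
  LinearMap.congr_fun hρ.counit m

end Slices

/-! ### Matrix coefficients and local finiteness of comodules -/

section MatrixCoefficients

variable {k H : Type*} [Field k] [Ring H] [HopfAlgebra k H]
variable {M : Type*} [AddCommGroup M] [Module k M]

variable (k) in
/-- A matrix over `H` is comultiplicative if it is the matrix of coefficients of a comodule
structure on a finite free `k`-module. -/
structure IsComultiplicative {n : ℕ} (h : Fin n → Fin n → H) : Prop where
  comul : ∀ i j, Coalgebra.comul (R := k) (h i j) = ∑ l, h i l ⊗ₜ[k] h l j
  counit : ∀ i j, Coalgebra.counit (R := k) (h i j) = if i = j then 1 else 0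

/-- The `k`-span of the family `w` is a subcomodule with coefficient matrix `h`. -/
def IsCoactionFamily {n : ℕ} (ρ : M →ₗ[k] M ⊗[k] H) (w : Fin n → M) (h : Fin n → Fin n → H) :
    Prop :=
  ∀ j, ρ (w j) = ∑ i, w i ⊗ₜ[k] h i j

/-- Local finiteness of comodules: a finite subset of a subcomodule `U` lies in a
finite-dimensional subcomodule contained in `U`. -/
theorem IsRightCoaction.exists_family {ρ : M →ₗ[k] M ⊗[k] H} (hρ : IsRightCoaction ρ)
    {U : Submodule k M} (hU : IsSubcomodule ρ U) (s : Finset M) (hs : ∀ x ∈ s, x ∈ U) :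
    ∃ (n : ℕ) (w : Fin n → M) (h : Fin n → Fin n → H), IsComultiplicative k h ∧
      IsCoactionFamily ρ w h ∧ (∀ j, w j ∈ U) ∧ ∀ x ∈ s, x ∈ Submodule.span k (Set.range w) := by
  classical
  rw [isSubcomodule_iff_slice] at hU
  -- The subcomodule generated by `s` is the span of all slices of its elements.
  let D : Submodule k M := Submodule.span k {y | ∃ x ∈ s, ∃ χ : Module.Dual k H, slice χ (ρ x) = y}
  have hDU : D ≤ U := by
    refine Submodule.span_le.2 ?_
    rintro _ ⟨x, hx, χ, rfl⟩
    exact hU x (hs x hx) χ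
  have hDs : ∀ x ∈ s, x ∈ D := fun x hx =>
    Submodule.subset_span ⟨x, hx, Coalgebra.counit, hρ.slice_counit x⟩
  have hD : ∀ x ∈ D, ∀ χ : Module.Dual k H, slice χ (ρ x) ∈ D := by
    intro x hx χ
    have : D ≤ D.comap (slice χ ∘ₗ ρ) := by
      refine Submodule.span_le.2 ?_
      rintro _ ⟨x, hx, ψ, rfl⟩
      change slice χ (ρ _) ∈ D
      rw [hρ.slice_slice]
      exact Submodule.subset_span ⟨x, hx, _, rfl⟩
    exact this hx
  have hfin : FiniteDimensional k D := by
    choose E hE hEm using fun x : M => exists_fg_slice_mem (ρ x)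
    have hfg : (⨆ x ∈ s, E x).FG := Submodule.fg_biSup s E fun x _ => hE x
    have hle : D ≤ ⨆ x ∈ s, E x := by
      refine Submodule.span_le.2 ?_
      rintro _ ⟨x, hx, χ, rfl⟩
      exact (le_iSup₂_of_le (f := fun x (_ : x ∈ s) => E x) x hx le_rfl) (hEm x χ)
    have : Module.Finite k (⨆ x ∈ s, E x : Submodule k M) := Module.Finite.iff_fg.2 hfg
    exact Submodule.finiteDimensional_of_le hle
  let b := Module.finBasis k D
  obtain ⟨g, hg⟩ := LinearMap.exists_leftInverse_of_injective D.subtype D.ker_subtype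
  have hgD : ∀ x : D, g x = x := fun x => LinearMap.congr_fun hg x
  -- Functionals on `M` dual to the chosen basis of `D`.
  let f : Fin (Module.finrank k D) → Module.Dual k M := fun i => b.coord i ∘ₗ g
  have hf : ∀ i j, f i (b j) = if i = j then 1 else 0 := by
    intro i j
    simp [f, hgD, Finsupp.single_apply, eq_comm]
  have hsum : ∀ x ∈ D, x = ∑ i, f i x • (b i : M) := by
    intro x hx
    have := congrArg Subtype.val (b.sum_repr ⟨x, hx⟩)
    simp only [f, LinearMap.comp_apply, Module.Basis.coord_apply]
    have e : g x = ⟨x, hx⟩ := hgD ⟨x, hx⟩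
    rw [e]
    rw [Submodule.coe_sum] at this
    exact this.symm
  let h : Fin (Module.finrank k D) → Fin (Module.finrank k D) → H := fun i j =>
    TensorProduct.lid k H ((f i).rTensor H (ρ (b j)))
  have hχ : ∀ (χ : Module.Dual k H) i j, χ (h i j) = f i (slice χ (ρ (b j))) := by
    intro χ i j
    simp only [h]
    induction ρ (b j : M) with
    | zero => simp
    | tmul m h => simp [mul_comm]
    | add x y hx hy => simp only [map_add, hx, hy]
  have hfam : IsCoactionFamily ρ (fun j => (b j : M)) h := by
    intro j
    refine eq_of_slice_eq fun χ => ?_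
    rw [hsum _ (hD _ (b j).2 χ)]
    simp [hχ]
  refine ⟨_, fun j => b j, h, ⟨fun i j => ?_, fun i j => ?_⟩, hfam, fun j => hDU (b j).2, ?_⟩
  · have h1 := LinearMap.congr_fun hρ.coassoc (b j : M)
    simp only [LinearMap.comp_apply, LinearEquiv.coe_coe] at h1
    rw [hfam j] at h1
    simp only [map_sum, LinearMap.rTensor_tmul, hfam _, TensorProduct.sum_tmul,
      TensorProduct.assoc_tmul, LinearMap.lTensor_tmul] at h1
    have h2 := congrArg (fun t => TensorProduct.lid k (H ⊗[k] H) ((f i).rTensor (H ⊗[k] H) t)) h1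
    simp only [map_sum, LinearMap.rTensor_tmul, TensorProduct.lid_tmul, hf, ite_smul, one_smul,
      zero_smul, Finset.sum_ite_eq, Finset.mem_univ, if_true] at h2
    exact h2.symm
  · rw [hχ, hρ.slice_counit, hf]
  · intro x hx
    rw [hsum x (hDs x hx)]
    exact Submodule.sum_mem _ fun i _ => Submodule.smul_mem _ _ (Submodule.subset_span ⟨i, rfl⟩)

/-- The antipode inverts a comultiplicative matrix. -/
theorem IsComultiplicative.sum_antipode_mul {n : ℕ} {h : Fin n → Fin n → H}
    (hh : IsComultiplicative k h) (i j : Fin n) :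
    ∑ l, HopfAlgebra.antipode k (h i l) * h l j = if i = j then 1 else 0 := by
  have := HopfAlgebra.mul_antipode_rTensor_comul_apply (R := k) (h i j)
  rw [hh.comul, hh.counit] at this
  simpa [apply_ite (algebraMap k H)] using this

theorem IsComultiplicative.sum_mul_antipode {n : ℕ} {h : Fin n → Fin n → H}
    (hh : IsComultiplicative k h) (i j : Fin n) :
    ∑ l, h i l * HopfAlgebra.antipode k (h l j) = if i = j then 1 else 0 := by
  have := HopfAlgebra.mul_antipode_lTensor_comul_apply (R := k) (h i j)
  rw [hh.comul, hh.counit] at this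
  simpa [apply_ite (algebraMap k H)] using this

end MatrixCoefficients

/-! ### Column and row coactions on free modules -/

section FreeHopfModules

variable {k H : Type*} [Field k] [Ring H] [HopfAlgebra k H]
variable {A : Type*} [Ring A] [Algebra k A]

theorem slice_mul_one_tmul (χ : Module.Dual k H) (t : A ⊗[k] H) (g : H) :
    slice χ (t * (1 ⊗ₜ g)) = slice (χ ∘ₗ LinearMap.mulRight k g) t := by
  induction t with
  | zero => simp
  | tmul a h => simp
  | add x y hx hy => simp only [add_mul, map_add, hx, hy]

theorem slice_mul_tmul_one (χ : Module.Dual k H) (t : A ⊗[k] H) (a : A) :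
    slice χ (t * (a ⊗ₜ 1)) = slice χ t * a := by
  induction t with
  | zero => simp
  | tmul a h => simp
  | add x y hx hy => simp only [add_mul, map_add, hx, hy]

variable {n : ℕ}

/-- The coaction `e_j a ↦ ∑ᵢ eᵢ a₀ ⊗ θᵢⱼ(a₁)` on `A ^ n`, for a matrix `θ` of endomorphisms of
`H`. -/
noncomputable def twistedCoaction (ρ : A →ₗ[k] A ⊗[k] H) (θ : Fin n → Fin n → H →ₗ[k] H) :
    (Fin n → A) →ₗ[k] (Fin n → A) ⊗[k] H :=
  ∑ i, ∑ j, TensorProduct.map (LinearMap.single k (fun _ => A) i) (θ i j) ∘ₗ ρ ∘ₗ LinearMap.proj j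

theorem twistedCoaction_apply (ρ : A →ₗ[k] A ⊗[k] H) (θ : Fin n → Fin n → H →ₗ[k] H)
    (x : Fin n → A) : twistedCoaction ρ θ x =
      ∑ i, ∑ j, TensorProduct.map (LinearMap.single k (fun _ => A) i) (θ i j) (ρ (x j)) := by
  simp [twistedCoaction, LinearMap.sum_apply]

theorem proj_twistedCoaction (ρ : A →ₗ[k] A ⊗[k] H) (θ : Fin n → Fin n → H →ₗ[k] H)
    (x : Fin n → A) (r : Fin n) :
    (LinearMap.proj (R := k) (φ := fun _ : Fin n => A) r).rTensor H (twistedCoaction ρ θ x) =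
      ∑ j, (θ r j).lTensor A (ρ (x j)) := by
  have key : ∀ (i j : Fin n) (t : A ⊗[k] H),
      (LinearMap.proj (R := k) (φ := fun _ : Fin n => A) r).rTensor H
        (TensorProduct.map (LinearMap.single k (fun _ => A) i) (θ i j) t) =
      if i = r then (θ r j).lTensor A t else 0 := by
    intro i j t
    induction t with
    | zero => simp
    | tmul a h =>
      by_cases hir : i = r
      · subst hir; simp
      · simp [hir]
    | add x y hx hy =>
      simp only [map_add, hx, hy]
      split_ifs <;> simp
  rw [twistedCoaction_apply]
  simp only [map_sum, key, Finset.sum_ite_irrel, Finset.sum_const_zero, Finset.sum_ite_eq',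
    Finset.mem_univ, if_true]

theorem slice_twistedCoaction (ρ : A →ₗ[k] A ⊗[k] H) (θ : Fin n → Fin n → H →ₗ[k] H)
    (χ : Module.Dual k H) (x : Fin n → A) (r : Fin n) :
    slice χ (twistedCoaction ρ θ x) r = slice χ (∑ j, (θ r j).lTensor A (ρ (x j))) := by
  rw [← proj_twistedCoaction, slice_rTensor]
  rfl

theorem isRightCoaction_twistedCoaction {ρ : A →ₗ[k] A ⊗[k] H} (hρ : IsRightCoaction ρ)
    {θ : Fin n → Fin n → H →ₗ[k] H}
    (hθ : ∀ i j g, Coalgebra.comul (R := k) (θ i j g) =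
      ∑ l, TensorProduct.map (θ i l) (θ l j) (Coalgebra.comul g))
    (hε : ∀ i j g, Coalgebra.counit (R := k) (θ i j g) = if i = j then Coalgebra.counit g else 0) :
    IsRightCoaction (twistedCoaction ρ θ) := by
  constructor
  · refine LinearMap.ext fun x => ?_
    have h := fun a => LinearMap.congr_fun hρ.coassoc a
    simp only [LinearMap.comp_apply, LinearEquiv.coe_coe] at h ⊢
    -- Both sides arise from the iterated coaction `a₀ ⊗ a₁ ⊗ a₂` of the entries of `x`.
    have h1 : ∀ (i j : Fin n) (t : A ⊗[k] H),
        TensorProduct.assoc k (Fin n → A) H H ((twistedCoaction ρ θ).rTensor H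
          (TensorProduct.map (LinearMap.single k (fun _ => A) i) (θ i j) t)) =
        ∑ l, TensorProduct.map (LinearMap.single k (fun _ => A) l)
          (TensorProduct.map (θ l i) (θ i j)) (TensorProduct.assoc k A H H (ρ.rTensor H t)) := by
      intro i j t
      induction t with
      | zero => simp
      | tmul a g =>
        have h2 : twistedCoaction ρ θ (Pi.single i a) = ∑ l,
            TensorProduct.map (LinearMap.single k (fun _ => A) l) (θ l i) (ρ a) := by
          rw [twistedCoaction_apply]
          refine Finset.sum_congr rfl fun l _ => ?_
          rw [Finset.sum_eq_single i]
          · simp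
          · intro b _ hb
            simp [hb]
          · simp
        simp only [TensorProduct.map_tmul, LinearMap.rTensor_tmul, LinearMap.coe_single, h2,
          TensorProduct.sum_tmul, map_sum]
        refine Finset.sum_congr rfl fun l _ => ?_
        induction ρ a with
        | zero => simp
        | tmul b g' => simp
        | add x y hx hy => simp only [map_add, TensorProduct.add_tmul, hx, hy]
      | add x y hx hy => simp only [map_add, hx, hy, Finset.sum_add_distrib]
    have h3 : ∀ (i j : Fin n) (t : A ⊗[k] H),
        (Coalgebra.comul (R := k) (A := H)).lTensor (Fin n → A)
          (TensorProduct.map (LinearMap.single k (fun _ => A) i) (θ i j) t) =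
        ∑ l, TensorProduct.map (LinearMap.single k (fun _ => A) i)
          (TensorProduct.map (θ i l) (θ l j))
            ((Coalgebra.comul (R := k) (A := H)).lTensor A t) := by
      intro i j t
      induction t with
      | zero => simp
      | tmul a g => simp [hθ, TensorProduct.tmul_sum]
      | add x y hx hy => simp only [map_add, hx, hy, Finset.sum_add_distrib]
    simp only [twistedCoaction_apply, map_sum, h1, h3, h]
    have swap : ∀ f : Fin n → Fin n → Fin n → (Fin n → A) ⊗[k] (H ⊗[k] H),
        ∑ i, ∑ j, ∑ l, f l i j = ∑ i, ∑ j, ∑ l, f i l j := by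
      intro f
      rw [Finset.sum_congr rfl fun i _ => Finset.sum_comm, Finset.sum_comm]
      exact Finset.sum_congr rfl fun _ _ => Finset.sum_comm
    exact swap _
  · refine LinearMap.ext fun x => ?_
    change slice Coalgebra.counit (twistedCoaction ρ θ x) = x
    ext r
    rw [slice_twistedCoaction]
    have h4 : ∀ j (t : A ⊗[k] H), slice Coalgebra.counit ((θ r j).lTensor A t) =
        if r = j then slice Coalgebra.counit t else 0 := by
      intro j t
      induction t with
      | zero => simp
      | tmul a g => simp [hε]
      | add x y hx hy =>
        simp only [map_add, hx, hy]
        split_ifs <;> simp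
    simp only [map_sum, h4, Finset.sum_ite_eq, Finset.mem_univ, if_true]
    exact hρ.slice_counit (x r)

/-- The coaction on the free right module `A ^ n` of columns for which the standard basis
generates a comodule with coefficient matrix `h`. -/
noncomputable def colCoaction (ρA : A →ₐ[k] A ⊗[k] H) (h : Fin n → Fin n → H) :
    (Fin n → A) →ₗ[k] (Fin n → A) ⊗[k] H :=
  twistedCoaction ρA.toLinearMap fun i j => LinearMap.mulLeft k (h i j)

/-- The coaction on the free left module `A ^ n` of rows, viewed as the dual of the module of
columns with `colCoaction ρA h`. -/
noncomputable def rowCoaction (ρA : A →ₐ[k] A ⊗[k] H) (h : Fin n → Fin n → H) :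
    (Fin n → A) →ₗ[k] (Fin n → A) ⊗[k] H :=
  twistedCoaction ρA.toLinearMap fun i j => LinearMap.mulRight k (HopfAlgebra.antipode k (h j i))

theorem proj_colCoaction (ρA : A →ₐ[k] A ⊗[k] H) (h : Fin n → Fin n → H) (x : Fin n → A)
    (r : Fin n) :
    (LinearMap.proj (R := k) (φ := fun _ : Fin n => A) r).rTensor H (colCoaction ρA h x) =
      ∑ j, (1 ⊗ₜ h r j) * ρA (x j) := by
  rw [colCoaction, proj_twistedCoaction]
  refine Finset.sum_congr rfl fun j _ => ?_
  change _ = _ * ρA.toLinearMap (x j)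
  induction ρA.toLinearMap (x j) with
  | zero => simp
  | tmul a g => simp
  | add x y hx hy => simp only [map_add, mul_add, hx, hy]

theorem proj_rowCoaction (ρA : A →ₐ[k] A ⊗[k] H) (h : Fin n → Fin n → H) (x : Fin n → A)
    (r : Fin n) :
    (LinearMap.proj (R := k) (φ := fun _ : Fin n => A) r).rTensor H (rowCoaction ρA h x) =
      ∑ j, ρA (x j) * (1 ⊗ₜ HopfAlgebra.antipode k (h j r)) := by
  rw [rowCoaction, proj_twistedCoaction]
  refine Finset.sum_congr rfl fun j _ => ?_
  change _ = ρA.toLinearMap (x j) * _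
  induction ρA.toLinearMap (x j) with
  | zero => simp
  | tmul a g => simp
  | add x y hx hy => simp only [map_add, add_mul, hx, hy]

theorem isRightCoaction_colCoaction {ρA : A →ₐ[k] A ⊗[k] H} (hρA : IsRightComoduleAlgebra ρA)
    {h : Fin n → Fin n → H} (hh : IsComultiplicative k h) :
    IsRightCoaction (colCoaction ρA h) := by
  refine isRightCoaction_twistedCoaction hρA (fun i j g => ?_) fun i j g => ?_
  · simp only [LinearMap.mulLeft_apply, Bialgebra.comul_mul, hh.comul, Finset.sum_mul]
    refine Finset.sum_congr rfl fun l _ => ?_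
    induction Coalgebra.comul (R := k) g with
    | zero => simp
    | tmul a b => simp
    | add x y hx hy => simp only [map_add, mul_add, hx, hy]
  · simp [hh.counit]

/-- The antipode is anticomultiplicative on the entries of a comultiplicative matrix. This holds
because the antipode inverts the matrix, and inverse matrices over `H ⊗ H` are unique. -/
theorem IsComultiplicative.comul_antipode {h : Fin n → Fin n → H} (hh : IsComultiplicative k h)
    (i j : Fin n) : Coalgebra.comul (R := k) (HopfAlgebra.antipode k (h i j)) =
      ∑ l, HopfAlgebra.antipode k (h l j) ⊗ₜ[k] HopfAlgebra.antipode k (h i l) := by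
  let X : Matrix (Fin n) (Fin n) (H ⊗[k] H) := Matrix.of fun i j =>
    Coalgebra.comul (R := k) (HopfAlgebra.antipode k (h i j))
  let Y : Matrix (Fin n) (Fin n) (H ⊗[k] H) := Matrix.of fun i j =>
    Coalgebra.comul (R := k) (h i j)
  let Z : Matrix (Fin n) (Fin n) (H ⊗[k] H) := Matrix.of fun i j =>
    ∑ l, HopfAlgebra.antipode k (h l j) ⊗ₜ[k] HopfAlgebra.antipode k (h i l)
  have hXY : X * Y = 1 := by
    ext i j
    simp only [Matrix.mul_apply, Matrix.of_apply, X, Y, ← Bialgebra.comul_mul, ← map_sum,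
      hh.sum_antipode_mul, Matrix.one_apply]
    split_ifs <;> simp
  have hYZ : Y * Z = 1 := by
    ext i j
    simp only [Matrix.mul_apply, Matrix.of_apply, Y, Z, hh.comul, Finset.sum_mul, Finset.mul_sum,
      Algebra.TensorProduct.tmul_mul_tmul, Matrix.one_apply]
    calc _ = ∑ l', ∑ l, (h i l * HopfAlgebra.antipode k (h l' j)) ⊗ₜ[k]
          (∑ x, h l x * HopfAlgebra.antipode k (h x l')) := by
          simp only [TensorProduct.tmul_sum]
          rw [Finset.sum_comm]
          exact Finset.sum_congr rfl fun _ _ => Finset.sum_comm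
      _ = ∑ l, (h i l * HopfAlgebra.antipode k (h l j)) ⊗ₜ[k] (1 : H) := by
          refine Finset.sum_congr rfl fun l _ => ?_
          simp only [hh.sum_mul_antipode, TensorProduct.tmul_ite,
            Finset.sum_ite_eq', Finset.mem_univ, if_true]
      _ = _ := by
          rw [← TensorProduct.sum_tmul, hh.sum_mul_antipode]
          split_ifs <;> simp [Algebra.TensorProduct.one_def]
  have hXZ : X = Z := by
    calc X = X * (Y * Z) := by rw [hYZ, mul_one]
      _ = Z := by rw [← mul_assoc, hXY, one_mul]
  exact congrFun (congrFun hXZ i) j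

theorem isRightCoaction_rowCoaction {ρA : A →ₐ[k] A ⊗[k] H} (hρA : IsRightComoduleAlgebra ρA)
    {h : Fin n → Fin n → H} (hh : IsComultiplicative k h) :
    IsRightCoaction (rowCoaction ρA h) := by
  refine isRightCoaction_twistedCoaction hρA (fun i j g => ?_) fun i j g => ?_
  · simp only [LinearMap.mulRight_apply, Bialgebra.comul_mul, hh.comul_antipode, Finset.mul_sum]
    refine Finset.sum_congr rfl fun l _ => ?_
    induction Coalgebra.comul (R := k) g with
    | zero => simp
    | tmul a b => simp
    | add x y hx hy => simp only [map_add, add_mul, hx, hy]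
  · simp [hh.counit, eq_comm]

theorem isRightHopfModule_colCoaction {ρA : A →ₐ[k] A ⊗[k] H} (hρA : IsRightComoduleAlgebra ρA)
    {h : Fin n → Fin n → H} (hh : IsComultiplicative k h) :
    IsRightHopfModule ρA (colCoaction ρA h) := by
  refine ⟨isRightCoaction_colCoaction hρA hh, fun x a => ?_⟩
  rw [colCoaction, twistedCoaction_apply, twistedCoaction_apply]
  simp only [map_sum, LinearMap.sum_apply]
  refine Finset.sum_congr rfl fun i _ => Finset.sum_congr rfl fun j _ => ?_
  have : ρA.toLinearMap ((MulOpposite.op a • x) j) = ρA.toLinearMap (x j) * ρA a := by simp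
  rw [this]
  induction ρA.toLinearMap (x j) with
  | zero => simp
  | tmul b g =>
    induction ρA a with
    | zero => simp
    | tmul c g' =>
      simp only [Algebra.TensorProduct.tmul_mul_tmul, TensorProduct.map_tmul, rightTensorAct,
        rightActBilin, TensorProduct.map₂_apply_tmul, LinearMap.mk₂_apply, LinearMap.mul_apply',
        LinearMap.mulLeft_apply, LinearMap.coe_single, mul_assoc]
      congr 1
      ext r
      by_cases hr : i = r
      · subst hr; simp
      · simp [Pi.single_eq_of_ne' hr]
    | add x y hx hy => simp only [mul_add, map_add, hx, hy]
  | add x y hx hy => simp only [add_mul, map_add, hx, hy, LinearMap.add_apply]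

end FreeHopfModules

/-! ### Stability under the coactions -/

section Stability

variable {k H : Type*} [Field k] [Ring H] [HopfAlgebra k H]
variable {A : Type*} [Ring A] [Algebra k A]
variable {n m r : ℕ}

section ColumnMap

variable {M : Type*} [AddCommGroup M] [Module Aᵐᵒᵖ M]

/-- The homomorphism of right modules `A ^ m → M` sending the standard basis to the family `w`. -/
def columnMap (w : Fin m → M) : (Fin m → A) →ₗ[Aᵐᵒᵖ] M where
  toFun y := ∑ j, MulOpposite.op (y j) • w j
  map_add' x y := by simp [add_smul, Finset.sum_add_distrib]
  map_smul' a y := by simp [Finset.smul_sum, smul_smul]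

theorem columnMap_apply (w : Fin m → M) (y : Fin m → A) :
    columnMap w y = ∑ j, MulOpposite.op (y j) • w j := rfl

@[simp]
theorem columnMap_single (w : Fin m → M) (j : Fin m) (a : A) :
    columnMap w (Pi.single j a) = MulOpposite.op a • w j := by
  rw [columnMap_apply, Finset.sum_eq_single j]
  · simp
  · intro i _ hi
    simp [hi]
  · simp

theorem range_columnMap (w : Fin m → M) :
    LinearMap.range (columnMap (A := A) w) = Submodule.span Aᵐᵒᵖ (Set.range w) := by
  apply le_antisymm
  · rintro _ ⟨y, rfl⟩
    rw [columnMap_apply]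
    exact Submodule.sum_mem _ fun j _ =>
      Submodule.smul_mem _ _ (Submodule.subset_span (Set.mem_range_self j))
  · refine Submodule.span_le.2 ?_
    rintro _ ⟨j, rfl⟩
    exact ⟨Pi.single j 1, by simp⟩

variable [Module k M] [IsScalarTower k Aᵐᵒᵖ M]

theorem columnMap_equivariant {ρA : A →ₐ[k] A ⊗[k] H} {ρM : M →ₗ[k] M ⊗[k] H}
    (hM : IsRightHopfModule ρA ρM) {w : Fin m → M} {h : Fin m → Fin m → H}
    (hw : IsCoactionFamily ρM w h) (y : Fin m → A) :
    ρM (columnMap w y) =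
      ((columnMap w).restrictScalars k).rTensor H (colCoaction ρA h y) := by
  have key : ∀ (i j : Fin m) (t : A ⊗[k] H),
      ((columnMap w).restrictScalars k).rTensor H
        (TensorProduct.map (LinearMap.single k (fun _ => A) i) (LinearMap.mulLeft k (h i j)) t) =
      rightTensorAct (w i ⊗ₜ[k] h i j) t := by
    intro i j t
    induction t with
    | zero => simp
    | tmul a g => simp [rightTensorAct, rightActBilin]
    | add x y hx hy => simp only [map_add, hx, hy]
  rw [columnMap_apply, map_sum, colCoaction, twistedCoaction_apply, Finset.sum_comm]
  simp only [map_sum, key, hM.smul, hw _, LinearMap.sum_apply]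
  rfl

theorem slice_columnMap {ρA : A →ₐ[k] A ⊗[k] H} {ρM : M →ₗ[k] M ⊗[k] H}
    (hM : IsRightHopfModule ρA ρM) {w : Fin m → M} {h : Fin m → Fin m → H}
    (hw : IsCoactionFamily ρM w h) (χ : Module.Dual k H) (y : Fin m → A) :
    slice χ (ρM (columnMap w y)) = columnMap w (slice χ (colCoaction ρA h y)) := by
  rw [columnMap_equivariant hM hw, slice_rTensor]
  rfl

theorem isSubcomodule_comap_columnMap {ρA : A →ₐ[k] A ⊗[k] H} {ρM : M →ₗ[k] M ⊗[k] H}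
    (hM : IsRightHopfModule ρA ρM) {w : Fin m → M} {h : Fin m → Fin m → H}
    (hw : IsCoactionFamily ρM w h) {N : Submodule Aᵐᵒᵖ M}
    (hN : IsSubcomodule ρM (N.restrictScalars k)) :
    IsSubcomodule (colCoaction ρA h) ((N.comap (columnMap w)).restrictScalars k) := by
  rw [isSubcomodule_iff_slice] at hN ⊢
  intro y hy χ
  change columnMap w _ ∈ N
  rw [← slice_columnMap hM hw]
  exact hN _ hy χ

theorem isSubcomodule_range_columnMap {ρA : A →ₐ[k] A ⊗[k] H} {ρM : M →ₗ[k] M ⊗[k] H}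
    (hM : IsRightHopfModule ρA ρM) {w : Fin m → M} {h : Fin m → Fin m → H}
    (hw : IsCoactionFamily ρM w h) :
    IsSubcomodule ρM ((LinearMap.range (columnMap (A := A) w)).restrictScalars k) := by
  rw [isSubcomodule_iff_slice]
  rintro _ ⟨y, rfl⟩ χ
  exact ⟨_, (slice_columnMap hM hw χ y).symm⟩

theorem isSubcomodule_bot (ρ : M →ₗ[k] M ⊗[k] H) :
    IsSubcomodule ρ ((⊥ : Submodule Aᵐᵒᵖ M).restrictScalars k) := by
  rw [isSubcomodule_iff_slice]
  intro u hu χ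
  have : u = 0 := hu
  simp [this]

theorem isSubcomodule_ker_columnMap {ρA : A →ₐ[k] A ⊗[k] H} {ρM : M →ₗ[k] M ⊗[k] H}
    (hM : IsRightHopfModule ρA ρM) {w : Fin m → M} {h : Fin m → Fin m → H}
    (hw : IsCoactionFamily ρM w h) :
    IsSubcomodule (colCoaction ρA h) ((LinearMap.ker (columnMap (A := A) w)).restrictScalars k) :=
  isSubcomodule_comap_columnMap hM hw (isSubcomodule_bot ρM)

theorem IsSubcomodule.sup {ρ : M →ₗ[k] M ⊗[k] H} {N N' : Submodule Aᵐᵒᵖ M}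
    (hN : IsSubcomodule ρ (N.restrictScalars k)) (hN' : IsSubcomodule ρ (N'.restrictScalars k)) :
    IsSubcomodule ρ ((N ⊔ N').restrictScalars k) := by
  rw [isSubcomodule_iff_slice] at hN hN' ⊢
  intro u hu χ
  obtain ⟨x, hx, y, hy, rfl⟩ := Submodule.mem_sup.1 hu
  rw [map_add, map_add]
  exact Submodule.add_mem_sup (hN x hx χ) (hN' y hy χ)

/-- Finitely many elements of a Hopf submodule `N` lie in a finitely generated Hopf submodule
of `N`. -/
theorem IsRightHopfModule.exists_fg_subcomodule {ρA : A →ₐ[k] A ⊗[k] H} {ρM : M →ₗ[k] M ⊗[k] H}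
    (hM : IsRightHopfModule ρA ρM) {N : Submodule Aᵐᵒᵖ M}
    (hN : IsSubcomodule ρM (N.restrictScalars k)) (s : Finset M) (hs : ∀ x ∈ s, x ∈ N) :
    ∃ (m : ℕ) (w : Fin m → M) (h : Fin m → Fin m → H), IsComultiplicative k h ∧
      IsCoactionFamily ρM w h ∧ LinearMap.range (columnMap (A := A) w) ≤ N ∧
      ∀ x ∈ s, ∃ c : Fin m → k, columnMap w (fun i => algebraMap k A (c i)) = x := by
  obtain ⟨m, w, h, hh, hw, hwN, hsw⟩ := hM.coaction.exists_family hN s hs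
  refine ⟨m, w, h, hh, hw, ?_, fun x hx => ?_⟩
  · rw [range_columnMap, Submodule.span_le]
    rintro _ ⟨j, rfl⟩
    exact hwN j
  · obtain ⟨c, hc⟩ := (Submodule.mem_span_range_iff_exists_fun k).1 (hsw x hx)
    refine ⟨c, ?_⟩
    rw [columnMap_apply, ← hc]
    refine Finset.sum_congr rfl fun j _ => ?_
    have : MulOpposite.op (algebraMap k A (c j)) = c j • (1 : Aᵐᵒᵖ) := by
      rw [Algebra.algebraMap_eq_smul_one]; rfl
    rw [this, smul_assoc, one_smul]

end ColumnMap

variable {ρA : A →ₐ[k] A ⊗[k] H}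

/-- The pairing of rows with columns is a homomorphism of comodules. -/
theorem sum_rowCoaction_mul_colCoaction {h : Fin n → Fin n → H} (hh : IsComultiplicative k h)
    (f y : Fin n → A) :
    ∑ s, (LinearMap.proj (R := k) (φ := fun _ : Fin n => A) s).rTensor H (rowCoaction ρA h f) *
        (LinearMap.proj (R := k) (φ := fun _ : Fin n => A) s).rTensor H (colCoaction ρA h y) =
      ρA (f ⬝ᵥ y) := by
  simp only [proj_rowCoaction, proj_colCoaction, Finset.sum_mul, Finset.mul_sum]
  have e : ∀ s i j : Fin n, ρA (f i) * (1 ⊗ₜ[k] HopfAlgebra.antipode k (h i s)) *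
      ((1 ⊗ₜ[k] h s j) * ρA (y j)) =
      ρA (f i) * ((1 ⊗ₜ[k] (HopfAlgebra.antipode k (h i s) * h s j)) * ρA (y j)) := by
    intro s i j
    rw [mul_assoc, ← mul_assoc (1 ⊗ₜ[k] _) (1 ⊗ₜ[k] _), Algebra.TensorProduct.tmul_mul_tmul,
      one_mul]
  simp only [e]
  calc _ = ∑ i, ∑ j, ρA (f i) *
        ((1 ⊗ₜ[k] ∑ s, HopfAlgebra.antipode k (h i s) * h s j) * ρA (y j)) := by
        simp only [TensorProduct.tmul_sum, Finset.sum_mul, Finset.mul_sum]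
        rw [Finset.sum_congr rfl fun s _ => Finset.sum_comm, Finset.sum_comm,
          Finset.sum_congr rfl fun s _ => Finset.sum_comm, Finset.sum_comm]
    _ = ∑ i, ρA (f i) * ρA (y i) := by
        refine Finset.sum_congr rfl fun i _ => ?_
        rw [Finset.sum_eq_single i]
        · rw [hh.sum_antipode_mul, if_pos rfl, ← Algebra.TensorProduct.one_def, one_mul]
        · intro j _ hj
          rw [hh.sum_antipode_mul, if_neg hj.symm]
          simp
        · simp
    _ = _ := by simp [dotProduct]

/-- The element `∑ₛ (f₀)ₛ yₛ ⊗ f₁` of `A ⊗ H` attached to a row `f` and a column `y`. -/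
noncomputable def rowPairing (ρA : A →ₐ[k] A ⊗[k] H) (h : Fin n → Fin n → H) (f y : Fin n → A) :
    A ⊗[k] H :=
  ∑ s, (LinearMap.proj (R := k) (φ := fun _ : Fin n => A) s).rTensor H (rowCoaction ρA h f) *
    (y s ⊗ₜ 1)

theorem slice_rowPairing (h : Fin n → Fin n → H) (f y : Fin n → A) (χ : Module.Dual k H) :
    slice χ (rowPairing ρA h f y) = slice χ (rowCoaction ρA h f) ⬝ᵥ y := by
  rw [rowPairing, map_sum, dotProduct]
  refine Finset.sum_congr rfl fun s _ => ?_
  rw [slice_mul_tmul_one, slice_rTensor]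
  rfl

theorem coaction_dotProduct {h : Fin n → Fin n → H} (hh : IsComultiplicative k h)
    {Y : Fin m → Fin n → A} {h' : Fin m → Fin m → H}
    (hY : IsCoactionFamily (colCoaction ρA h) Y h') (f : Fin n → A) (j : Fin m) :
    ρA (f ⬝ᵥ Y j) = ∑ i, rowPairing ρA h f (Y i) * (1 ⊗ₜ h' i j) := by
  rw [← sum_rowCoaction_mul_colCoaction hh, hY j]
  simp only [rowPairing, Finset.sum_mul, map_sum, LinearMap.rTensor_tmul, Finset.mul_sum]
  rw [Finset.sum_comm]
  refine Finset.sum_congr rfl fun i _ => Finset.sum_congr rfl fun s _ => ?_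
  rw [mul_assoc, Algebra.TensorProduct.tmul_mul_tmul, mul_one, one_mul]
  rfl

theorem rowPairing_eq {h : Fin n → Fin n → H} (hh : IsComultiplicative k h)
    {Y : Fin m → Fin n → A} {h' : Fin m → Fin m → H} (hh' : IsComultiplicative k h')
    (hY : IsCoactionFamily (colCoaction ρA h) Y h') (f : Fin n → A) (l : Fin m) :
    rowPairing ρA h f (Y l) =
      ∑ j, ρA (f ⬝ᵥ Y j) * (1 ⊗ₜ HopfAlgebra.antipode k (h' j l)) := by
  simp only [coaction_dotProduct hh hY, Finset.sum_mul]
  rw [Finset.sum_comm]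
  have e : ∀ i, ∑ j, rowPairing ρA h f (Y i) * (1 ⊗ₜ h' i j) *
      (1 ⊗ₜ HopfAlgebra.antipode k (h' j l)) =
      if i = l then rowPairing ρA h f (Y i) else 0 := by
    intro i
    simp only [mul_assoc, Algebra.TensorProduct.tmul_mul_tmul, one_mul]
    rw [← Finset.mul_sum, ← TensorProduct.tmul_sum, hh'.sum_mul_antipode]
    split_ifs <;> simp [← Algebra.TensorProduct.one_def]
  simp [e]

/-- The rows annihilating a set of columns `K`. -/
def rowAnnihilator (K : Set (Fin n → A)) : Submodule A (Fin n → A) where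
  carrier := {f | ∀ y ∈ K, f ⬝ᵥ y = 0}
  add_mem' hf hg y hy := by rw [add_dotProduct, hf y hy, hg y hy, add_zero]
  zero_mem' y _ := zero_dotProduct y
  smul_mem' a f hf y hy := by rw [smul_dotProduct, hf y hy, smul_zero]

theorem isSubcomodule_rowAnnihilator (hρA : IsRightComoduleAlgebra ρA)
    {h : Fin n → Fin n → H} (hh : IsComultiplicative k h)
    {K : Submodule Aᵐᵒᵖ (Fin n → A)}
    (hK : IsSubcomodule (colCoaction ρA h) (K.restrictScalars k)) :
    IsSubcomodule (rowCoaction ρA h)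
      ((rowAnnihilator (K : Set (Fin n → A))).restrictScalars k) := by
  rw [isSubcomodule_iff_slice]
  intro f hf χ y hy
  obtain ⟨m, Y, h', hh', hY, hYK, hyY⟩ :=
    (isRightCoaction_colCoaction hρA hh).exists_family hK {y} (by simpa using hy)
  have hzero : ∀ l, slice χ (rowCoaction ρA h f) ⬝ᵥ Y l = 0 := by
    intro l
    rw [← slice_rowPairing, rowPairing_eq hh hh' hY]
    have : ∀ j, f ⬝ᵥ Y j = 0 := fun j => hf _ (hYK j)
    simp [this]
  obtain ⟨c, rfl⟩ := (Submodule.mem_span_range_iff_exists_fun k).1 (hyY y (by simp))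
  rw [dotProduct_sum]
  simp [hzero]

/-- The left submodule of rows of the form `(g · X₁, …, g · Xₘ)`. -/
def rowRange (X : Fin m → Fin n → A) : Submodule A (Fin m → A) :=
  LinearMap.range ({ toFun := fun g j => g ⬝ᵥ X j
                     map_add' := fun f g => by ext j; simp [add_dotProduct]
                     map_smul' := fun a g => by ext j; simp [smul_dotProduct] } :
    (Fin n → A) →ₗ[A] (Fin m → A))

theorem mem_rowRange {X : Fin m → Fin n → A} {f : Fin m → A} :
    f ∈ rowRange X ↔ ∃ g : Fin n → A, (fun j => g ⬝ᵥ X j) = f := Iff.rfl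

theorem isSubcomodule_rowRange
    {h : Fin n → Fin n → H} (hh : IsComultiplicative k h)
    {X : Fin m → Fin n → A} {h' : Fin m → Fin m → H} (hh' : IsComultiplicative k h')
    (hX : IsCoactionFamily (colCoaction ρA h) X h') :
    IsSubcomodule (rowCoaction ρA h') ((rowRange X).restrictScalars k) := by
  rw [isSubcomodule_iff_slice]
  rintro _ ⟨g, rfl⟩ χ
  refine ⟨slice χ (rowCoaction ρA h g), ?_⟩
  ext l
  change slice χ (rowCoaction ρA h g) ⬝ᵥ X l =
    LinearMap.proj (R := k) (φ := fun _ : Fin m => A) l (slice χ (rowCoaction ρA h' _))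
  rw [← slice_rTensor, proj_rowCoaction, ← slice_rowPairing, rowPairing_eq hh hh' hX]
  rfl

/-- If `L` is a stable left module of rows, then the elements of `A` multiplying a
finite-dimensional subcomodule of rows into `L` form a stable left ideal. -/
theorem isSubcomodule_conductor
    {h : Fin n → Fin n → H} {L : Submodule A (Fin n → A)}
    (hL : IsSubcomodule (rowCoaction ρA h) (L.restrictScalars k))
    {f : Fin r → Fin n → A} {u : Fin r → Fin r → H} (hu : IsComultiplicative k u)
    (hf : IsCoactionFamily (rowCoaction ρA h) f u) :
    IsSubcomodule ρA.toLinearMap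
      ((⨅ i, L.comap (LinearMap.toSpanSingleton A (Fin n → A) (f i))).restrictScalars k) := by
  rw [isSubcomodule_iff_slice] at hL ⊢
  intro a ha χ
  have ha' : ∀ i, a • f i ∈ L := fun i => (Submodule.mem_iInf _).1 ha i
  refine (Submodule.mem_iInf _).2 fun l => ?_
  change slice χ (ρA a) • f l ∈ L
  have hcomp : ∀ s, ρA a * (f l s ⊗ₜ[k] (1 : H)) = ∑ i,
      (LinearMap.proj (R := k) (φ := fun _ : Fin n => A) s).rTensor H (rowCoaction ρA h (a • f i)) *
        (1 ⊗ₜ HopfAlgebra.antipode k (u i l)) := by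
    intro s
    have h1 : ∀ i, (LinearMap.proj (R := k) (φ := fun _ : Fin n => A) s).rTensor H
        (rowCoaction ρA h (a • f i)) = ρA a * ∑ j, f j s ⊗ₜ[k] u j i := by
      intro i
      have h2 : ∑ j, f j s ⊗ₜ[k] u j i = (LinearMap.proj (R := k) (φ := fun _ : Fin n => A)
          s).rTensor H (rowCoaction ρA h (f i)) := by
        rw [hf i]
        simp
      rw [h2, proj_rowCoaction, proj_rowCoaction, Finset.mul_sum]
      simp [mul_assoc]
    simp only [h1, mul_assoc, ← Finset.mul_sum]
    congr 1
    simp only [Finset.sum_mul, Algebra.TensorProduct.tmul_mul_tmul, mul_one]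
    rw [Finset.sum_comm]
    simp only [← TensorProduct.tmul_sum, hu.sum_mul_antipode, TensorProduct.tmul_ite]
    simp
  have : slice χ (ρA a) • f l = ∑ i, slice (χ ∘ₗ LinearMap.mulRight k
      (HopfAlgebra.antipode k (u i l))) (rowCoaction ρA h (a • f i)) := by
    ext s
    rw [Pi.smul_apply, smul_eq_mul, ← slice_mul_tmul_one, hcomp, map_sum, Finset.sum_apply]
    refine Finset.sum_congr rfl fun i _ => ?_
    rw [slice_mul_one_tmul, slice_rTensor]
    rfl
  rw [this]
  exact Submodule.sum_mem _ fun i _ => hL _ (ha' i) _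

theorem slice_tmul_mul (χ : Module.Dual k H) (c : A) (g : H) (t : A ⊗[k] H) :
    slice χ ((c ⊗ₜ[k] g) * t) = c * slice (χ ∘ₗ LinearMap.mulLeft k g) t := by
  induction t with
  | zero => simp
  | tmul a h => simp
  | add x y hx hy => simp only [mul_add, map_add, hx, hy]

theorem slice_mul_mem {I : Submodule A A} {t : A ⊗[k] H}
    (ht : ∀ χ : Module.Dual k H, slice χ t ∈ I) (b : A ⊗[k] H) (χ : Module.Dual k H) :
    slice χ (b * t) ∈ I := by
  induction b with
  | zero => simp
  | tmul c g =>
    rw [slice_tmul_mul]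
    exact I.smul_mem c (ht _)
  | add x y hx hy =>
    rw [add_mul, map_add]
    exact I.add_mem hx hy

/-- A relative trace ideal: the values `f · y` with `f` in a stable module of rows and `y` in a
stable module of columns span a stable left ideal. -/
theorem isSubcomodule_span_dotProduct (hρA : IsRightComoduleAlgebra ρA)
    {h : Fin n → Fin n → H} (hh : IsComultiplicative k h)
    {L : Submodule A (Fin n → A)}
    (hL : IsSubcomodule (rowCoaction ρA h) (L.restrictScalars k))
    {K : Submodule Aᵐᵒᵖ (Fin n → A)}
    (hK : IsSubcomodule (colCoaction ρA h) (K.restrictScalars k)) :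
    IsSubcomodule ρA.toLinearMap
      ((Submodule.span A {a | ∃ f ∈ L, ∃ y ∈ K, f ⬝ᵥ y = a}).restrictScalars k) := by
  rw [isSubcomodule_iff_slice] at hL ⊢
  intro a ha
  induction ha using Submodule.span_induction with
  | mem a ha =>
    obtain ⟨f, hf, y, hy, rfl⟩ := ha
    intro χ
    obtain ⟨m, Y, h', hh', hY, hYK, hyY⟩ :=
      (isRightCoaction_colCoaction hρA hh).exists_family hK {y} (by simpa using hy)
    obtain ⟨c, rfl⟩ := (Submodule.mem_span_range_iff_exists_fun k).1 (hyY y (by simp))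
    rw [dotProduct_sum, map_sum, map_sum]
    refine Submodule.sum_mem _ fun j _ => ?_
    rw [dotProduct_smul, map_smul, map_smul]
    refine Submodule.smul_mem _ _ ?_
    change slice χ (ρA (f ⬝ᵥ Y j)) ∈ _
    rw [coaction_dotProduct hh hY, map_sum]
    refine Submodule.sum_mem _ fun i _ => ?_
    rw [slice_mul_one_tmul, slice_rowPairing]
    exact Submodule.subset_span ⟨_, hL f hf _, _, hYK i, rfl⟩
  | zero => simp
  | add a b _ _ ha hb =>
    intro χ
    rw [map_add, map_add]
    exact Submodule.add_mem _ (ha χ) (hb χ)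
  | smul c a _ ha =>
    intro χ
    change slice χ (ρA (c * a)) ∈ _
    rw [map_mul]
    exact slice_mul_mem ha (ρA c) χ

end Stability

/-! ### Von Neumann regular quotient rings -/

section Regular

variable {R : Type*} [Ring R]

/-- In a von Neumann regular ring a finitely generated left ideal contains a right identity for
its generators. -/
theorem IsVonNeumannRegularRing.exists_right_identity (hR : IsVonNeumannRegularRing R)
    (s : Finset R) : ∃ e ∈ Submodule.span R (s : Set R), ∀ x ∈ s, x * e = x := by
  classical
  induction s using Finset.induction_on with
  | empty => exact ⟨0, Submodule.zero_mem _, by simp⟩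
  | insert x s _ ih =>
    obtain ⟨e, he, hes⟩ := ih
    obtain ⟨y, hy⟩ := hR (x - x * e)
    have hle : Submodule.span R (s : Set R) ≤ Submodule.span R (insert x s : Finset R) :=
      Submodule.span_mono (by simp)
    have hx : x ∈ Submodule.span R ((insert x s : Finset R) : Set R) :=
      Submodule.subset_span (by simp)
    refine ⟨e + (1 - e) * y * (x - x * e), ?_, fun z hz => ?_⟩
    · refine Submodule.add_mem _ (hle he) (Submodule.smul_mem _ ((1 - e) * y) ?_)
      exact Submodule.sub_mem _ hx (Submodule.smul_mem _ x (hle he))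
    · rcases Finset.mem_insert.1 hz with rfl | hz
      · calc z * (e + (1 - e) * y * (z - z * e))
            = z * e + (z - z * e) * y * (z - z * e) := by noncomm_ring
          _ = z := by rw [hy]; abel
      · calc z * (e + (1 - e) * y * (x - x * e))
            = z * e + (z - z * e) * y * (x - x * e) := by noncomm_ring
          _ = z := by rw [hes z hz]; simp

/-- Over a von Neumann regular ring every finite family of columns is fixed by an endomorphism
with values in its span; so finitely generated submodules of free modules split off. -/
theorem IsVonNeumannRegularRing.exists_projection (hR : IsVonNeumannRegularRing R) {n : ℕ}
    (s : Finset (Fin n → R)) :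
    ∃ p : (Fin n → R) →ₗ[Rᵐᵒᵖ] (Fin n → R),
      (∀ v, p v ∈ Submodule.span Rᵐᵒᵖ (s : Set (Fin n → R))) ∧ ∀ x ∈ s, p x = x := by
  classical
  induction s using Finset.induction_on with
  | empty => exact ⟨0, fun v => by simp, by simp⟩
  | insert x s _ ih =>
    obtain ⟨p, hp, hps⟩ := ih
    have hle : Submodule.span Rᵐᵒᵖ (s : Set (Fin n → R)) ≤
        Submodule.span Rᵐᵒᵖ ((insert x s : Finset (Fin n → R)) : Set (Fin n → R)) :=
      Submodule.span_mono (by simp)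
    have hx : x ∈ Submodule.span Rᵐᵒᵖ ((insert x s : Finset (Fin n → R)) : Set (Fin n → R)) :=
      Submodule.subset_span (by simp)
    obtain ⟨e, he, hee⟩ := hR.exists_right_identity (Finset.univ.image (x - p x))
    rw [Finset.coe_image, Finset.coe_univ, Set.image_univ] at he
    obtain ⟨y, hy⟩ := (Submodule.mem_span_range_iff_exists_fun R).1 he
    -- The projection onto the cyclic module generated by `x - p x`.
    let q : (Fin n → R) →ₗ[Rᵐᵒᵖ] (Fin n → R) :=
      { toFun := fun v => MulOpposite.op (y ⬝ᵥ v) • (x - p x)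
        map_add' := fun v v' => by simp only [dotProduct_add, MulOpposite.op_add, add_smul]
        map_smul' := fun c v => by
          rw [dotProduct_smul, RingHom.id_apply, smul_smul]
          rfl }
    have hq : q (x - p x) = x - p x := by
      ext i
      change (x - p x) i * (y ⬝ᵥ (x - p x)) = (x - p x) i
      have : y ⬝ᵥ (x - p x) = e := hy
      rw [this]
      exact hee _ (Finset.mem_image_of_mem _ (Finset.mem_univ i))
    refine ⟨p + q ∘ₗ (LinearMap.id - p), fun v => ?_, fun z hz => ?_⟩
    · refine Submodule.add_mem _ (hle (hp v)) (Submodule.smul_mem _ _ ?_)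
      exact Submodule.sub_mem _ hx (hle (hp x))
    · simp only [LinearMap.add_apply, LinearMap.comp_apply, LinearMap.sub_apply, LinearMap.id_apply]
      rcases Finset.mem_insert.1 hz with rfl | hz
      · rw [hq]; abel
      · rw [hps z hz]; simp

/-- Rectangular matrices over a von Neumann regular ring have generalized inverses. -/
theorem IsVonNeumannRegularRing.exists_generalizedInverse (hR : IsVonNeumannRegularRing R)
    {n m : ℕ} (X : Fin m → Fin n → R) :
    ∃ c : Fin n → Fin m → R, ∀ j, columnMap X (columnMap c (X j)) = X j := by
  classical
  obtain ⟨p, hp, hpX⟩ := hR.exists_projection (Finset.univ.image X)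
  have h : ∀ b : Fin n, ∃ c : Fin m → R, columnMap X c = p (Pi.single b 1) := by
    intro b
    have := hp (Pi.single b 1)
    rw [Finset.coe_image, Finset.coe_univ, Set.image_univ, ← range_columnMap] at this
    exact this
  choose c hc using h
  have hpc : columnMap X ∘ₗ columnMap c = p := by
    have hsingle : ∀ (b : Fin n) (a : R), columnMap X (columnMap c (Pi.single b a)) =
        p (Pi.single b a) := by
      intro b a
      have : (Pi.single b a : Fin n → R) = MulOpposite.op a • Pi.single b (1 : R) := by
        rw [← Pi.single_smul]; simp
      rw [columnMap_single, map_smul, hc, this, map_smul]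
    refine LinearMap.ext fun v => ?_
    rw [← Finset.univ_sum_single v, map_sum, map_sum]
    exact Finset.sum_congr rfl fun b _ => hsingle b _
  refine ⟨c, fun j => ?_⟩
  rw [← LinearMap.comp_apply, hpc]
  exact hpX _ (Finset.mem_image_of_mem _ (Finset.mem_univ j))

end Regular

section Fractions

variable {A Q : Type*} [Ring A] [Ring Q] {ι : A →+* Q}

theorem IsClassicalQuotientRing.exists_common_left (hQ : IsClassicalQuotientRing ι)
    (s : Finset Q) : ∃ d ∈ nonZeroDivisors A, ∀ q ∈ s, ∃ a, ι d * q = ι a := by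
  classical
  induction s using Finset.induction_on with
  | empty => exact ⟨1, one_mem _, by simp⟩
  | insert x s _ ih =>
    obtain ⟨d, hd, hds⟩ := ih
    obtain ⟨t, ht, a, ha⟩ := hQ.left_fraction (ι d * x)
    refine ⟨t * d, mul_mem ht hd, fun q hq => ?_⟩
    rcases Finset.mem_insert.1 hq with rfl | hq
    · exact ⟨a, by rw [map_mul, mul_assoc, ha]⟩
    · obtain ⟨b, hb⟩ := hds q hq
      exact ⟨t * b, by rw [map_mul, map_mul, mul_assoc, hb]⟩

theorem IsClassicalQuotientRing.exists_common_right (hQ : IsClassicalQuotientRing ι)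
    (s : Finset Q) : ∃ d ∈ nonZeroDivisors A, ∀ q ∈ s, ∃ a, q * ι d = ι a := by
  classical
  induction s using Finset.induction_on with
  | empty => exact ⟨1, one_mem _, by simp⟩
  | insert x s _ ih =>
    obtain ⟨d, hd, hds⟩ := ih
    obtain ⟨t, ht, a, ha⟩ := hQ.right_fraction (x * ι d)
    refine ⟨d * t, mul_mem hd ht, fun q hq => ?_⟩
    rcases Finset.mem_insert.1 hq with rfl | hq
    · exact ⟨a, by rw [map_mul, ← mul_assoc, ha]⟩
    · obtain ⟨b, hb⟩ := hds q hq
      exact ⟨b * t, by rw [map_mul, map_mul, ← mul_assoc, hb]⟩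

/-- A row vanishing on the relations between the columns of `X` is of the form `g X` over the von
Neumann regular quotient ring; clearing denominators, a multiple of it has this form over `A`. -/
theorem IsClassicalQuotientRing.exists_smul_mem_rowRange (hQ : IsClassicalQuotientRing ι)
    (hreg : IsVonNeumannRegularRing Q) {n m r : ℕ} (X : Fin m → Fin n → A)
    (f : Fin r → Fin m → A)
    (hf : ∀ i, f i ∈ rowAnnihilator (LinearMap.ker (columnMap (A := A) X) : Set (Fin m → A))) :
    ∃ d ∈ nonZeroDivisors A, ∀ i, d • f i ∈ rowRange X := by
  classical
  let XQ : Fin m → Fin n → Q := fun j b => ι (X j b)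
  obtain ⟨c, hc⟩ := hreg.exists_generalizedInverse XQ
  have hfc : ∀ i j, (fun l => ι (f i l)) ⬝ᵥ columnMap c (XQ j) = ι (f i j) := by
    intro i j
    let z : Fin m → Q := columnMap c (XQ j) - Pi.single j 1
    have hz : columnMap XQ z = 0 := by
      simp only [z, map_sub, hc, columnMap_single]
      simp
    obtain ⟨t, ht, hzt⟩ := hQ.exists_common_right (Finset.univ.image z)
    have hzt' : ∀ l, ∃ a, z l * ι t = ι a := fun l =>
      hzt _ (Finset.mem_image_of_mem _ (Finset.mem_univ l))
    choose a ha using hzt'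
    have hXa : columnMap X a = 0 := by
      ext b
      apply hQ.injective
      have h1 := congrFun hz b
      simp only [columnMap_apply, Finset.sum_apply, Pi.smul_apply, op_smul_eq_mul,
        Pi.zero_apply, map_sum, map_mul, map_zero, XQ] at h1 ⊢
      simp only [← ha, ← mul_assoc, ← Finset.sum_mul, h1, zero_mul]
    have h2 := congrArg ι (hf i a hXa)
    simp only [dotProduct, map_sum, map_mul, map_zero, ← ha, ← mul_assoc, ← Finset.sum_mul] at h2
    have h3 : (fun l => ι (f i l)) ⬝ᵥ z = 0 := by
      rw [dotProduct]
      exact (hQ.isUnit t ht).mul_left_eq_zero.1 h2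
    rw [dotProduct_sub, sub_eq_zero] at h3
    rw [h3]
    simp
  obtain ⟨d, hd, hdψ⟩ := hQ.exists_common_left
    (Finset.univ.image fun p : Fin r × Fin n => (fun l => ι (f p.1 l)) ⬝ᵥ c p.2)
  have hdψ' : ∀ i b, ∃ a, ι d * ((fun l => ι (f i l)) ⬝ᵥ c b) = ι a := fun i b =>
    hdψ _ (Finset.mem_image.2 ⟨(i, b), Finset.mem_univ _, rfl⟩)
  choose g hg using hdψ'
  refine ⟨d, hd, fun i => mem_rowRange.2 ⟨g i, ?_⟩⟩
  ext j
  apply hQ.injective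
  rw [Pi.smul_apply, smul_eq_mul, map_mul, ← hfc i j, columnMap_apply, dotProduct_sum,
    dotProduct, map_sum, Finset.mul_sum]
  refine Finset.sum_congr rfl fun b _ => ?_
  rw [map_mul, ← hg, dotProduct_smul, op_smul_eq_mul, mul_assoc]

end Fractions

/-! ### Coherence and projective dimension -/

section Coherent

/-- If the finitely generated submodules of `B` are finitely presented, then so are those
of `B ^ n`. -/
theorem finitePresentation_of_fg_pi {R B : Type*} [Ring R] [AddCommGroup B] [Module R B]
    (hB : ∀ I : Submodule R B, I.FG → Module.FinitePresentation R I) {n : ℕ}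
    (K : Submodule R (Fin n → B)) (hK : K.FG) : Module.FinitePresentation R K := by
  induction n with
  | zero => infer_instance
  | succ n ih =>
    have : Module.Finite R K := Module.Finite.iff_fg.2 hK
    let l : K →ₗ[R] B := LinearMap.proj 0 ∘ₗ K.subtype
    have hl : (LinearMap.range l).FG := Module.Finite.iff_fg.1 inferInstance
    have := hB _ hl
    have hker : (LinearMap.ker l.rangeRestrict).FG :=
      Module.FinitePresentation.fg_ker _ l.surjective_rangeRestrict
    have : Module.Finite R (LinearMap.ker l.rangeRestrict) := Module.Finite.iff_fg.2 hker
    let τ : LinearMap.ker l.rangeRestrict →ₗ[R] (Fin n → B) :=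
      LinearMap.funLeft R B Fin.succ ∘ₗ K.subtype ∘ₗ (LinearMap.ker l.rangeRestrict).subtype
    have hτ : Function.Injective τ := by
      intro x y hxy
      have h0 : ∀ z : LinearMap.ker l.rangeRestrict, (z : Fin (n + 1) → B) 0 = 0 := fun z =>
        congrArg Subtype.val z.2
      ext i
      refine Fin.cases ?_ (fun j => congrFun hxy j) i
      rw [h0, h0]
    have := ih (LinearMap.range τ) (Module.Finite.iff_fg.1 inferInstance)
    have := Module.FinitePresentation.of_equiv (R := R)
      (M := LinearMap.range τ) (N := LinearMap.ker l.rangeRestrict)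
      (LinearEquiv.ofInjective τ hτ).symm
    exact Module.finitePresentation_of_ker l.rangeRestrict l.surjective_rangeRestrict

theorem IsRightCoherentRing.finitePresentation_pi {A : Type*} [Ring A]
    (hA : IsRightCoherentRing A) {n : ℕ} (K : Submodule Aᵐᵒᵖ (Fin n → A)) (hK : K.FG) :
    Module.FinitePresentation Aᵐᵒᵖ K :=
  finitePresentation_of_fg_pi hA K hK

end Coherent

section ProjectiveDimension

open CategoryTheory

universe u v

variable {R : Type u} [Ring R]

/-- Dimension shifting for a submodule of a projective module. -/
theorem hasProjectiveDimensionLT_of_quotient [Small.{v} R] {P : Type v} [AddCommGroup P]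
    [Module R P] [Module.Projective R P] (K : Submodule R P) (d : ℕ)
    (h : HasProjectiveDimensionLT (ModuleCat.of R (P ⧸ K)) (d + 2)) :
    HasProjectiveDimensionLT (ModuleCat.of R K) (d + 1) := by
  have hS := LinearMap.shortExact_shortComplexKer K.mkQ_surjective
  have hP : Projective (ModuleCat.of R P) := (IsProjective.iff_projective P).1 inferInstance
  have h1 : HasProjectiveDimensionLT (ModuleCat.of R (LinearMap.ker K.mkQ)) (d + 1) :=
    (hS.hasProjectiveDimensionLT_X₃_iff d hP).1 h
  rwa [K.ker_mkQ] at h1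

theorem projective_of_hasProjectiveDimensionLT_one [Small.{v} R] {P : Type v} [AddCommGroup P]
    [Module R P] (h : HasProjectiveDimensionLT (ModuleCat.of R P) 1) : Module.Projective R P :=
  (IsProjective.iff_projective P).2 (projective_iff_hasProjectiveDimensionLT_one.2 h)

end ProjectiveDimension

/-! ### Quotients of free Hopf modules by finitely generated Hopf submodules -/

section Quotients

theorem opLinear_eq_dotProduct {A : Type*} [Ring A] {m : ℕ} (φ : (Fin m → A) →ₗ[Aᵐᵒᵖ] A)
    (y : Fin m → A) : φ y = (fun l => φ (Pi.single l 1)) ⬝ᵥ y := by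
  conv_lhs => rw [← Finset.univ_sum_single y, map_sum]
  refine Finset.sum_congr rfl fun l _ => ?_
  have : (Pi.single l (y l) : Fin m → A) = MulOpposite.op (y l) • Pi.single l (1 : A) := by
    rw [← Pi.single_smul]; simp
  rw [this, map_smul, op_smul_eq_mul]

/-- The right module `A ^ m` as a power of the regular module of `Aᵐᵒᵖ`. -/
def opPiEquiv (A : Type*) [Ring A] (m : ℕ) : (Fin m → Aᵐᵒᵖ) ≃ₗ[Aᵐᵒᵖ] (Fin m → A) :=
  LinearEquiv.piCongrRight fun _ => (MulOpposite.opLinearEquiv Aᵐᵒᵖ (M := A)).symm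

theorem projective_op_pi (A : Type*) [Ring A] (m : ℕ) : Module.Projective Aᵐᵒᵖ (Fin m → A) :=
  Module.Projective.of_equiv (opPiEquiv A m)

theorem finite_op_pi (A : Type*) [Ring A] (m : ℕ) : Module.Finite Aᵐᵒᵖ (Fin m → A) :=
  Module.Finite.equiv (opPiEquiv A m)

/-- Multiplication of columns by the matrix with rows `g j`. -/
def rowsMap {A : Type*} [Ring A] {n m : ℕ} (g : Fin m → Fin n → A) :
    (Fin n → A) →ₗ[Aᵐᵒᵖ] (Fin m → A) where
  toFun v j := g j ⬝ᵥ v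
  map_add' v v' := by ext j; simp [dotProduct_add]
  map_smul' c v := by ext j; simp [dotProduct_smul]

/-- If `K` is projective and all functionals on `K` extend to `A ^ n`, then `K` is a direct
summand of `A ^ n`. Here `K` is the span of the columns `X`. -/
theorem projective_quotient_of_extension {A : Type*} [Ring A] {n m : ℕ} (X : Fin m → Fin n → A)
    (hproj : Module.Projective Aᵐᵒᵖ (LinearMap.range (columnMap (A := A) X)))
    (hext : rowAnnihilator (LinearMap.ker (columnMap (A := A) X) : Set (Fin m → A)) ≤
      rowRange X) :
    Module.Projective Aᵐᵒᵖ ((Fin n → A) ⧸ LinearMap.range (columnMap (A := A) X)) := by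
  let T := (columnMap (A := A) X).rangeRestrict
  obtain ⟨σ, hσ⟩ := Module.projective_lifting_property T LinearMap.id
    (columnMap (A := A) X).surjective_rangeRestrict
  have hf : ∀ j, (fun l => σ (T (Pi.single l 1)) j) ∈ rowRange X := by
    intro j
    refine hext fun y hy => ?_
    have hTy : T y = 0 := Subtype.ext hy
    have := opLinear_eq_dotProduct (LinearMap.proj j ∘ₗ σ ∘ₗ T) y
    simp only [LinearMap.comp_apply, hTy, map_zero] at this
    exact this.symm
  choose g hg using fun j => mem_rowRange.1 (hf j)
  -- `p` is an idempotent endomorphism of `A ^ n` with image the span of the columns.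
  let p : (Fin n → A) →ₗ[Aᵐᵒᵖ] (Fin n → A) := columnMap X ∘ₗ rowsMap g
  have hpX : ∀ l, p (X l) = X l := by
    intro l
    have h1 : rowsMap g (X l) = σ (T (Pi.single l 1)) := by
      ext j
      exact congrFun (hg j) l
    have h2 := congrArg Subtype.val (LinearMap.congr_fun hσ (T (Pi.single l 1)))
    change columnMap X (σ (T (Pi.single l 1))) = columnMap X (Pi.single l 1) at h2
    change columnMap X (rowsMap g (X l)) = X l
    rw [h1, h2]
    simp
  have hle : LinearMap.range (columnMap (A := A) X) ≤ LinearMap.ker (LinearMap.id - p) := by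
    rw [range_columnMap, Submodule.span_le]
    rintro _ ⟨l, rfl⟩
    simp [hpX]
  have := projective_op_pi A n
  refine Module.Projective.of_split (Submodule.liftQ _ (LinearMap.id - p) hle)
    (Submodule.mkQ _) ?_
  ext1
  refine LinearMap.ext fun v => ?_
  change Submodule.Quotient.mk (v - p v) = Submodule.Quotient.mk v
  rw [Submodule.Quotient.eq]
  simp only [sub_sub_cancel_left, neg_mem_iff]
  exact ⟨_, rfl⟩

variable {k H : Type*} [Field k] [Ring H] [HopfAlgebra k H]
variable {A : Type uA} [Ring A] [Algebra k A]
variable {Q : Type*} [Ring Q] {ι : A →+* Q} {ρA : A →ₐ[k] A ⊗[k] H}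
variable {n m : ℕ}

/-- Vanishing of `Ext¹` into `A`: every functional on the Hopf submodule of `A ^ n` generated by
the columns `X` extends to `A ^ n`. A functional extends after multiplication by a nonzerodivisor,
and the multipliers which work for a whole finite-dimensional subcomodule of functionals form a
stable left ideal, so that simplicity of `A` makes `1` a multiplier. -/
theorem rowAnnihilator_le_rowRange (hρA : IsRightComoduleAlgebra ρA)
    (hsimple : IsSimpleLeftHopfModule ρA ρA.toLinearMap) (hQ : IsClassicalQuotientRing ι)
    (hreg : IsVonNeumannRegularRing Q) {h : Fin n → Fin n → H} (hh : IsComultiplicative k h)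
    {X : Fin m → Fin n → A} {h' : Fin m → Fin m → H} (hh' : IsComultiplicative k h')
    (hX : IsCoactionFamily (colCoaction ρA h) X h') :
    rowAnnihilator (LinearMap.ker (columnMap (A := A) X) : Set (Fin m → A)) ≤ rowRange X := by
  have := hsimple.nontrivial
  intro f hf
  have hker := isSubcomodule_ker_columnMap (isRightHopfModule_colCoaction hρA hh) hX
  obtain ⟨r, Φ, u, hu, hΦ, hΦK, hfΦ⟩ := (isRightCoaction_rowCoaction hρA hh').exists_family
    (isSubcomodule_rowAnnihilator hρA hh' hker) {f} (by simpa using hf)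
  obtain ⟨d, hd, hdL⟩ := hQ.exists_smul_mem_rowRange hreg X Φ hΦK
  have hJ := hsimple.eq_bot_or_eq_top _
    (isSubcomodule_conductor (isSubcomodule_rowRange hh hh' hX) hu hΦ)
  have hdJ : d ∈ ⨅ i, (rowRange X).comap (LinearMap.toSpanSingleton A (Fin m → A) (Φ i)) :=
    (Submodule.mem_iInf _).2 fun i => hdL i
  rcases hJ with hJ | hJ
  · rw [hJ, Submodule.mem_bot] at hdJ
    exact absurd hdJ (nonZeroDivisors.ne_zero hd)
  · have h1 : (1 : A) ∈ ⨅ i, (rowRange X).comap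
        (LinearMap.toSpanSingleton A (Fin m → A) (Φ i)) := hJ ▸ Submodule.mem_top
    have hΦL : ∀ i, Φ i ∈ rowRange X := fun i => by
      simpa using (Submodule.mem_iInf _).1 h1 i
    have hspan : Submodule.span k (Set.range Φ) ≤ (rowRange X).restrictScalars k := by
      rw [Submodule.span_le]
      rintro _ ⟨i, rfl⟩
      exact hΦL i
    exact hspan (hfΦ f (by simp))

/-- Finitely generated Hopf submodules of `A ^ n` with quotient of finite projective dimension are
direct summands. The projective dimension drops along a presentation of the submodule by another
free Hopf module, so that by induction the submodule is projective. -/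
theorem projective_quotient_of_hasProjectiveDimensionLT (hρA : IsRightComoduleAlgebra ρA)
    (hsimple : IsSimpleLeftHopfModule ρA ρA.toLinearMap) (hQ : IsClassicalQuotientRing ι)
    (hreg : IsVonNeumannRegularRing Q) (hcoh : IsRightCoherentRing A) (d : ℕ) {n : ℕ}
    {h : Fin n → Fin n → H} (hh : IsComultiplicative k h) {K : Submodule Aᵐᵒᵖ (Fin n → A)}
    (hK : IsSubcomodule (colCoaction ρA h) (K.restrictScalars k)) (hfg : K.FG)
    (hd : CategoryTheory.HasProjectiveDimensionLT (ModuleCat.of Aᵐᵒᵖ ((Fin n → A) ⧸ K)) (d + 1)) :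
    Module.Projective Aᵐᵒᵖ ((Fin n → A) ⧸ K) := by
  induction d generalizing n with
  | zero => exact projective_of_hasProjectiveDimensionLT_one hd
  | succ d ih =>
    have hF := isRightHopfModule_colCoaction hρA hh
    obtain ⟨s, hs⟩ := hfg
    obtain ⟨m, X, h', hh', hX, hXK, hsX⟩ := hF.exists_fg_subcomodule hK s fun x hx =>
      hs ▸ Submodule.subset_span hx
    obtain rfl : LinearMap.range (columnMap (A := A) X) = K := by
      refine le_antisymm hXK ?_
      rw [← hs, Submodule.span_le]
      intro x hx
      obtain ⟨c, hc⟩ := hsX x hx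
      exact ⟨_, hc⟩
    have := hcoh.finitePresentation_pi _ ⟨s, hs⟩
    have := finite_op_pi A m
    have hker : (LinearMap.ker (columnMap (A := A) X)).FG := by
      have := Module.FinitePresentation.fg_ker (columnMap (A := A) X).rangeRestrict
        (columnMap (A := A) X).surjective_rangeRestrict
      rwa [LinearMap.ker_rangeRestrict] at this
    have e := (columnMap (A := A) X).quotKerEquivRange
    have := projective_op_pi A n
    have hd' := hasProjectiveDimensionLT_of_quotient _ d hd
    have hproj := ih hh' (isSubcomodule_ker_columnMap hF hX) hker
      (CategoryTheory.hasProjectiveDimensionLT_of_iso e.symm.toModuleIso (d + 1))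
    exact projective_quotient_of_extension X (Module.Projective.of_equiv e)
      (rowAnnihilator_le_rowRange hρA hsimple hQ hreg hh hh' hX)

theorem projective_quotient_of_fg (hρA : IsRightComoduleAlgebra ρA)
    (hsimple : IsSimpleLeftHopfModule ρA ρA.toLinearMap) (hQ : IsClassicalQuotientRing ι)
    (hreg : IsVonNeumannRegularRing Q) (hcoh : IsRightCoherentRing A)
    (hpd : ∀ (V : Type uA) [AddCommGroup V] [Module Aᵐᵒᵖ V], Module.FinitePresentation Aᵐᵒᵖ V →
      CategoryTheory.projectiveDimension (ModuleCat.of Aᵐᵒᵖ V) < ⊤)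
    {h : Fin n → Fin n → H} (hh : IsComultiplicative k h) {K : Submodule Aᵐᵒᵖ (Fin n → A)}
    (hK : IsSubcomodule (colCoaction ρA h) (K.restrictScalars k)) (hfg : K.FG) :
    Module.Projective Aᵐᵒᵖ ((Fin n → A) ⧸ K) := by
  have := projective_op_pi A n
  have := finite_op_pi A n
  have hfp := Module.finitePresentation_of_projective Aᵐᵒᵖ (Fin n → A)
  have hfp' : Module.FinitePresentation Aᵐᵒᵖ ((Fin n → A) ⧸ K) :=
    Module.finitePresentation_of_surjective K.mkQ K.mkQ_surjective (by rwa [K.ker_mkQ])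
  obtain ⟨d, hd⟩ := (CategoryTheory.projectiveDimension_ne_top_iff _).1 (hpd _ hfp').ne
  exact projective_quotient_of_hasProjectiveDimensionLT hρA hsimple hQ hreg hcoh d hh hK hfg hd

end Quotients

/-! ### Flatness of right modules -/

section Flatness

universe uP

variable {A : Type uA} [Ring A]

theorem isRightFlat_iff {M : Type uM} [AddCommGroup M] [Module Aᵐᵒᵖ M] :
    IsRightFlat.{uA, uM, uN} A M ↔
      ∀ (N N' : Type uN) [AddCommGroup N] [Module A N] [AddCommGroup N'] [Module A N']
        (f : N →ₗ[A] N'), Function.Injective f → ∀ x : M ⊗[ℤ] N,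
          f.toAddMonoidHom.toIntLinearMap.lTensor M x ∈ balancedRelations A M N' →
            x ∈ balancedRelations A M N := by
  refine forall₂_congr fun N N' => forall₄_congr fun _ _ _ _ => forall₂_congr fun f _ => ?_
  rw [injective_iff_map_eq_zero]
  refine ⟨fun h x hx => ?_, fun h x hx => ?_⟩
  · rw [← QuotientAddGroup.eq_zero_iff]
    apply h
    change ((_ : M ⊗[ℤ] N') : BalancedTensor A M N') = 0
    rwa [QuotientAddGroup.eq_zero_iff]
  · obtain ⟨x, rfl⟩ := QuotientAddGroup.mk_surjective x
    rw [QuotientAddGroup.eq_zero_iff]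
    apply h
    rwa [← QuotientAddGroup.eq_zero_iff]

theorem rTensor_mem_balancedRelations {M : Type*} {M' : Type*} [AddCommGroup M] [Module Aᵐᵒᵖ M]
    [AddCommGroup M'] [Module Aᵐᵒᵖ M'] {N : Type*} [AddCommGroup N] [Module A N]
    (g : M →ₗ[Aᵐᵒᵖ] M') {x : M ⊗[ℤ] N} (hx : x ∈ balancedRelations A M N) :
    g.toAddMonoidHom.toIntLinearMap.rTensor N x ∈ balancedRelations A M' N := by
  have : balancedRelations A M N ≤ (balancedRelations A M' N).comap
      (g.toAddMonoidHom.toIntLinearMap.rTensor N).toAddMonoidHom := by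
    refine (AddSubgroup.closure_le _).2 ?_
    rintro _ ⟨m, a, n, rfl⟩
    exact AddSubgroup.subset_closure ⟨g m, a, n, by simp⟩
  exact this hx

/-- Relations in `M' ⊗ N` lift along a surjection `M → M'`. -/
theorem exists_rTensor_eq_of_mem_balancedRelations {M : Type*} {M' : Type*} [AddCommGroup M]
    [Module Aᵐᵒᵖ M] [AddCommGroup M'] [Module Aᵐᵒᵖ M'] {N : Type*} [AddCommGroup N] [Module A N]
    (g : M →ₗ[Aᵐᵒᵖ] M') (hg : Function.Surjective g) {y : M' ⊗[ℤ] N}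
    (hy : y ∈ balancedRelations A M' N) :
    ∃ x ∈ balancedRelations A M N, g.toAddMonoidHom.toIntLinearMap.rTensor N x = y := by
  have : balancedRelations A M' N ≤ (balancedRelations A M N).map
      (g.toAddMonoidHom.toIntLinearMap.rTensor N).toAddMonoidHom := by
    refine (AddSubgroup.closure_le _).2 ?_
    rintro _ ⟨m, a, n, rfl⟩
    obtain ⟨m, rfl⟩ := hg m
    exact ⟨_, AddSubgroup.subset_closure ⟨m, a, n, rfl⟩, by simp⟩
  exact this hy

theorem isRightFlat_of_projective (P : Type uP) [AddCommGroup P] [Module Aᵐᵒᵖ P]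
    [Module.Projective Aᵐᵒᵖ P] : IsRightFlat.{uA, uP, uN} A P := by
  classical
  obtain ⟨s, hs⟩ := (Module.projective_def' (R := Aᵐᵒᵖ) (P := P)).1 inferInstance
  rw [isRightFlat_iff]
  intro N N' _ _ _ _ f hf x hx
  -- The coordinates `p ⊗ n ↦ (s(p)_q n)_q` of an element of `P ⊗ N` in a free cover of `P`.
  let T : ∀ (N : Type uN) [AddCommGroup N] [Module A N], P ⊗[ℤ] N →ₗ[ℤ] (P →₀ N) :=
    fun N _ _ => TensorProduct.lift (LinearMap.mk₂ ℤ
      (fun p n => (s p).mapRange (fun a => a.unop • n) (by simp))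
      (fun p p' n => by ext q; simp [add_smul]) (fun c p n => by
        ext q
        simp only [map_zsmul, Finsupp.mapRange_apply, Finsupp.smul_apply, MulOpposite.unop_smul,
          smul_assoc])
      (fun p n n' => by ext q; simp) (fun c p n => by
        ext q
        simp only [Finsupp.mapRange_apply, Finsupp.smul_apply]
        exact smul_comm _ _ _))
  have hT : ∀ (N : Type uN) [AddCommGroup N] [Module A N] (p : P) (n : N) (q : P),
      T N (p ⊗ₜ n) q = (s p q).unop • n := fun N _ _ p n q => rfl
  have hTrel : ∀ (N : Type uN) [AddCommGroup N] [Module A N],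
      balancedRelations A P N ≤ (T N).toAddMonoidHom.ker := by
    intro N _ _
    refine (AddSubgroup.closure_le _).2 ?_
    rintro _ ⟨p, a, n, rfl⟩
    change T N ((MulOpposite.op a • p) ⊗ₜ[ℤ] n - p ⊗ₜ[ℤ] (a • n)) = 0
    ext q
    simp [hT, mul_smul]
  have hnat : ∀ (y : P ⊗[ℤ] N) (q : P),
      T N' (f.toAddMonoidHom.toIntLinearMap.lTensor P y) q = f (T N y q) := by
    intro y q
    induction y with
    | zero => simp
    | tmul p n => simp [hT]
    | add y z hy hz => simp only [map_add, Finsupp.add_apply, hy, hz]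
  have hTx : T N x = 0 := by
    ext q
    apply hf
    rw [← hnat]
    have : T N' (f.toAddMonoidHom.toIntLinearMap.lTensor P x) = 0 := hTrel N' hx
    simp [this]
  let U : (P →₀ N) →+ P ⊗[ℤ] N :=
    Finsupp.liftAddHom fun p => (TensorProduct.mk ℤ P N p).toAddMonoidHom
  have hU : ∀ y : P ⊗[ℤ] N, y - U (T N y) ∈ balancedRelations A P N := by
    intro y
    induction y with
    | zero => simp
    | tmul p n =>
      have h1 : p ⊗ₜ[ℤ] n = ∑ q ∈ (s p).support, (s p q • q) ⊗ₜ[ℤ] n := by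
        have := LinearMap.congr_fun hs p
        simp only [LinearMap.comp_apply, Finsupp.linearCombination_apply, Finsupp.sum,
          LinearMap.id_apply, id] at this
        rw [← TensorProduct.sum_tmul, this]
      have h2 : U (T N (p ⊗ₜ n)) = ∑ q ∈ (s p).support, q ⊗ₜ[ℤ] ((s p q).unop • n) := by
        change (T N (p ⊗ₜ n)).sum (fun q n => q ⊗ₜ[ℤ] n) = _
        rw [Finsupp.sum_of_support_subset (s := (s p).support)]
        · simp only [hT]
        · intro q hq
          rw [Finsupp.mem_support_iff, hT] at hq
          rw [Finsupp.mem_support_iff]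
          intro h0
          simp [h0] at hq
        · simp
      rw [h2, h1, ← Finset.sum_sub_distrib]
      exact AddSubgroup.sum_mem _ fun q _ =>
        AddSubgroup.subset_closure ⟨q, (s p q).unop, n, by simp⟩
    | add y z hy hz =>
      rw [map_add, map_add, add_sub_add_comm]
      exact AddSubgroup.add_mem _ hy hz
  have := hU x
  rwa [hTx, map_zero, sub_zero] at this

/-- A right module `M` is flat if every finite amount of data in a free presentation of `M`
(a finite set of generators and a finite set of relations) factors through a projective module. -/
theorem isRightFlat_of_factorization {M : Type uM} [AddCommGroup M] [Module Aᵐᵒᵖ M]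
    (hM : ∀ (S : Finset M) (κ : Finset (M →₀ Aᵐᵒᵖ)),
      (∀ z ∈ κ, Finsupp.linearCombination Aᵐᵒᵖ (id : M → M) z = 0) →
      ∃ (P : Type uP) (_ : AddCommGroup P) (_ : Module Aᵐᵒᵖ P) (_ : Module.Projective Aᵐᵒᵖ P)
        (α : (M →₀ Aᵐᵒᵖ) →ₗ[Aᵐᵒᵖ] P) (β : P →ₗ[Aᵐᵒᵖ] M),
        (∀ z ∈ κ, α z = 0) ∧ ∀ x ∈ S, β (α (Finsupp.single x 1)) = x) :
    IsRightFlat.{uA, uM, uN} A M := by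
  classical
  rw [isRightFlat_iff]
  intro N N' _ _ _ _ f hf x hx
  let π : (M →₀ Aᵐᵒᵖ) →ₗ[Aᵐᵒᵖ] M := Finsupp.linearCombination Aᵐᵒᵖ id
  have hπ : Function.Surjective π := fun m => ⟨Finsupp.single m 1, by simp [π]⟩
  let πZ := π.toAddMonoidHom.toIntLinearMap
  let fZ := f.toAddMonoidHom.toIntLinearMap
  obtain ⟨S, y, hSy⟩ : ∃ (S : Finset M) (y : (M →₀ Aᵐᵒᵖ) ⊗[ℤ] N),
      πZ.rTensor N y = x ∧ ∀ (P : Type uP) [AddCommGroup P] [Module Aᵐᵒᵖ P]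
        (α : (M →₀ Aᵐᵒᵖ) →ₗ[Aᵐᵒᵖ] P) (β : P →ₗ[Aᵐᵒᵖ] M),
        (∀ x ∈ S, β (α (Finsupp.single x 1)) = x) →
        β.toAddMonoidHom.toIntLinearMap.rTensor N
          (α.toAddMonoidHom.toIntLinearMap.rTensor N y) = x := by
    clear hx
    induction x with
    | zero => exact ⟨∅, 0, by simp, by simp⟩
    | tmul m n =>
      refine ⟨{m}, Finsupp.single m 1 ⊗ₜ n, by simp [πZ, π], fun P _ _ α β h => ?_⟩
      have := h m (by simp)
      simp [this]
    | add x x' hx hx' =>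
      obtain ⟨S, y, hy, hS⟩ := hx
      obtain ⟨S', y', hy', hS'⟩ := hx'
      refine ⟨S ∪ S', y + y', by rw [map_add, hy, hy'], fun P _ _ α β h => ?_⟩
      rw [map_add, map_add, hS P α β fun z hz => h z (Finset.mem_union_left _ hz),
        hS' P α β fun z hz => h z (Finset.mem_union_right _ hz)]
  obtain ⟨hy, hS⟩ := hSy
  obtain ⟨t, ht, htx⟩ := exists_rTensor_eq_of_mem_balancedRelations π hπ hx
  have hcomm : ∀ z : (M →₀ Aᵐᵒᵖ) ⊗[ℤ] N, πZ.rTensor N' (fZ.lTensor _ z) =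
      fZ.lTensor _ (πZ.rTensor N z) := fun z => by
    rw [← LinearMap.comp_apply, ← LinearMap.comp_apply, LinearMap.rTensor_comp_lTensor,
      LinearMap.lTensor_comp_rTensor]
  have hkerπ : fZ.lTensor _ y - t ∈ LinearMap.ker (πZ.rTensor N') := by
    rw [LinearMap.mem_ker, map_sub, hcomm, hy, sub_eq_zero]
    exact htx.symm
  have hex : Function.Exact (LinearMap.ker πZ).subtype πZ := LinearMap.exact_subtype_ker_map πZ
  obtain ⟨z, hz⟩ := (rTensor_exact N' hex hπ _).1 hkerπ
  -- Only finitely many elements of the kernel of `π` occur in `z`.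
  obtain ⟨κ, hκ, hκz⟩ : ∃ κ : Finset (M →₀ Aᵐᵒᵖ), (∀ w ∈ κ, π w = 0) ∧
      ∀ (P : Type uP) [AddCommGroup P] [Module Aᵐᵒᵖ P] (α : (M →₀ Aᵐᵒᵖ) →ₗ[Aᵐᵒᵖ] P),
        (∀ w ∈ κ, α w = 0) → α.toAddMonoidHom.toIntLinearMap.rTensor N'
          ((LinearMap.ker πZ).subtype.rTensor N' z) = 0 := by
    clear hz
    induction z with
    | zero => exact ⟨∅, by simp, by simp⟩
    | tmul w n =>
      refine ⟨{(w : M →₀ Aᵐᵒᵖ)}, fun w' hw' => ?_, fun P _ _ α h => ?_⟩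
      · rw [Finset.mem_singleton] at hw'
        rw [hw']
        exact w.2
      · have := h w (by simp)
        simp [this]
    | add z z' hz hz' =>
      obtain ⟨κ, hκ, h⟩ := hz
      obtain ⟨κ', hκ', h'⟩ := hz'
      refine ⟨κ ∪ κ', fun w hw => ?_, fun P _ _ α hα => ?_⟩
      · rcases Finset.mem_union.1 hw with hw | hw
        exacts [hκ w hw, hκ' w hw]
      · rw [map_add, map_add, h P α fun w hw => hα w (Finset.mem_union_left _ hw),
          h' P α fun w hw => hα w (Finset.mem_union_right _ hw), add_zero]
  obtain ⟨P, _, _, _, α, β, hα, hαβ⟩ := hM S κ hκ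
  rw [← hS P α β hαβ]
  refine rTensor_mem_balancedRelations β ?_
  refine isRightFlat_iff.1 (isRightFlat_of_projective P) N N' f hf _ ?_
  have h1 := hκz P α hα
  rw [hz, map_sub, sub_eq_zero] at h1
  have h2 := rTensor_mem_balancedRelations α ht
  rw [← h1] at h2
  have h3 : fZ.lTensor P (α.toAddMonoidHom.toIntLinearMap.rTensor N y) =
      α.toAddMonoidHom.toIntLinearMap.rTensor N' (fZ.lTensor _ y) := by
    rw [← LinearMap.comp_apply, ← LinearMap.comp_apply, LinearMap.rTensor_comp_lTensor,
      LinearMap.lTensor_comp_rTensor]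
  change fZ.lTensor P (α.toAddMonoidHom.toIntLinearMap.rTensor N y) ∈ _
  rw [h3]
  exact h2

end Flatness

/-! ### Finite generation of Hopf submodules -/

section FiniteGeneration

variable {k H : Type*} [Field k] [Ring H] [HopfAlgebra k H]
variable {A : Type uA} [Ring A] [Algebra k A]
variable {ρA : A →ₐ[k] A ⊗[k] H} {n : ℕ}

/-- The submodule of `R ^ n` generated by the image of a submodule of `A ^ n` under a ring
homomorphism `A → R`. -/
def columnSpanMap {A R : Type*} [Ring A] [Ring R] (θ : A →+* R) {n : ℕ}
    (K : Submodule Aᵐᵒᵖ (Fin n → A)) : Submodule Rᵐᵒᵖ (Fin n → R) :=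
  Submodule.span Rᵐᵒᵖ ((fun x i => θ (x i)) '' (K : Set (Fin n → A)))

theorem columnSpanMap_mono {A R : Type*} [Ring A] [Ring R] (θ : A →+* R) {n : ℕ}
    {K K' : Submodule Aᵐᵒᵖ (Fin n → A)} (h : K ≤ K') : columnSpanMap θ K ≤ columnSpanMap θ K' :=
  Submodule.span_mono (Set.image_mono h)

/-- If `A ^ n / K₀` is projective, then stable submodules containing `K₀` are detected by a base
change along any ring homomorphism `A → R ≠ 0`. Otherwise a functional vanishing on `K₀` is
nonzero on `K₁`, so the values on `K₁` of such functionals generate `A` as a left ideal, but they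
all map to zero in `R`. -/
theorem le_of_columnSpanMap_le (hρA : IsRightComoduleAlgebra ρA)
    (hsimple : IsSimpleLeftHopfModule ρA ρA.toLinearMap) {R : Type*} [Ring R] [Nontrivial R]
    (θ : A →+* R) {h : Fin n → Fin n → H} (hh : IsComultiplicative k h)
    {K₀ K₁ : Submodule Aᵐᵒᵖ (Fin n → A)}
    (hK₀ : IsSubcomodule (colCoaction ρA h) (K₀.restrictScalars k))
    (hK₁ : IsSubcomodule (colCoaction ρA h) (K₁.restrictScalars k))
    (hproj : Module.Projective Aᵐᵒᵖ ((Fin n → A) ⧸ K₀))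
    (hle : columnSpanMap θ K₁ ≤ columnSpanMap θ K₀) : K₁ ≤ K₀ := by
  intro x hx
  by_contra hx₀
  obtain ⟨s, hs⟩ := (Module.projective_def' (R := Aᵐᵒᵖ) (P := (Fin n → A) ⧸ K₀)).1 hproj
  have hsx : s (K₀.mkQ x) ≠ 0 := by
    intro h0
    have h1 := LinearMap.congr_fun hs (K₀.mkQ x)
    rw [LinearMap.comp_apply, h0, map_zero, LinearMap.id_apply, Submodule.mkQ_apply] at h1
    exact hx₀ ((Submodule.Quotient.mk_eq_zero _).1 h1.symm)
  obtain ⟨q, hq⟩ := Finsupp.ne_iff.1 hsx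
  let φ : (Fin n → A) →ₗ[Aᵐᵒᵖ] A :=
    (MulOpposite.opLinearEquiv Aᵐᵒᵖ (M := A)).symm.toLinearMap ∘ₗ
      Finsupp.lapply q ∘ₗ s ∘ₗ K₀.mkQ
  let f : Fin n → A := fun l => φ (Pi.single l 1)
  have hφ : ∀ y, f ⬝ᵥ y = φ y := fun y => (opLinear_eq_dotProduct φ y).symm
  have hf : f ∈ rowAnnihilator (K₀ : Set (Fin n → A)) := by
    intro y hy
    have : K₀.mkQ y = 0 := (Submodule.Quotient.mk_eq_zero _).2 hy
    rw [hφ]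
    simp only [φ, LinearMap.comp_apply, this, map_zero]
  have hfx : f ⬝ᵥ x ≠ 0 := by
    rw [hφ]
    intro h0
    exact hq (MulOpposite.unop_injective h0)
  let I : Submodule A A := Submodule.span A
    {a | ∃ f ∈ rowAnnihilator (K₀ : Set (Fin n → A)), ∃ y ∈ K₁, f ⬝ᵥ y = a}
  have hI : I = ⊤ := by
    refine (hsimple.eq_bot_or_eq_top I (isSubcomodule_span_dotProduct hρA hh
      (isSubcomodule_rowAnnihilator hρA hh hK₀) hK₁)).resolve_left fun h0 => hfx ?_
    have : f ⬝ᵥ x ∈ I := Submodule.subset_span ⟨f, hf, x, hx, rfl⟩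
    rwa [h0, Submodule.mem_bot] at this
  have hθ : ∀ a ∈ I, θ a = 0 := by
    intro a ha
    induction ha using Submodule.span_induction with
    | mem a ha =>
      obtain ⟨g, hg, y, hy, rfl⟩ := ha
      let ψ : (Fin n → R) →ₗ[Rᵐᵒᵖ] R :=
        { toFun := fun v => (fun i => θ (g i)) ⬝ᵥ v
          map_add' := fun v v' => dotProduct_add _ _ _
          map_smul' := fun c v => dotProduct_smul _ _ _ }
      have hψ : ∀ z : Fin n → A, ψ (fun i => θ (z i)) = θ (g ⬝ᵥ z) := fun z => by
        simp [ψ, dotProduct]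
      have hker : columnSpanMap θ K₀ ≤ LinearMap.ker ψ := by
        refine Submodule.span_le.2 ?_
        rintro _ ⟨z, hz, rfl⟩
        change ψ (fun i => θ (z i)) = 0
        rw [hψ, hg z hz, map_zero]
      have hy' : (fun i => θ (y i)) ∈ LinearMap.ker ψ :=
        hker (hle (Submodule.subset_span ⟨y, hy, rfl⟩))
      rwa [LinearMap.mem_ker, hψ] at hy'
    | zero => exact map_zero θ
    | add a b _ _ ha hb => rw [map_add, ha, hb, add_zero]
    | smul c a _ ha => rw [smul_eq_mul, map_mul, ha, mul_zero]
  have h1 := hθ 1 (hI ▸ Submodule.mem_top)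
  rw [map_one] at h1
  exact one_ne_zero h1

/-- In the presence of a homomorphism from `A` to a right Noetherian ring, Hopf submodules of
`A ^ n` are finitely generated. -/
theorem fg_of_isSubcomodule (hρA : IsRightComoduleAlgebra ρA)
    (hsimple : IsSimpleLeftHopfModule ρA ρA.toLinearMap)
    (hproj : ∀ {n : ℕ} {h : Fin n → Fin n → H} {K : Submodule Aᵐᵒᵖ (Fin n → A)},
      IsComultiplicative k h → IsSubcomodule (colCoaction ρA h) (K.restrictScalars k) → K.FG →
      Module.Projective Aᵐᵒᵖ ((Fin n → A) ⧸ K))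
    {R : Type*} [Ring R] [Nontrivial R] [IsNoetherian Rᵐᵒᵖ R] (θ : A →+* R)
    {h : Fin n → Fin n → H} (hh : IsComultiplicative k h) {K : Submodule Aᵐᵒᵖ (Fin n → A)}
    (hK : IsSubcomodule (colCoaction ρA h) (K.restrictScalars k)) : K.FG := by
  let S : Set (Submodule Rᵐᵒᵖ (Fin n → R)) := {W | ∃ K₀ ≤ K, K₀.FG ∧
    IsSubcomodule (colCoaction ρA h) (K₀.restrictScalars k) ∧ columnSpanMap θ K₀ = W}
  have hS : S.Nonempty := ⟨_, ⊥, bot_le, Submodule.fg_bot, isSubcomodule_bot _, rfl⟩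
  obtain ⟨_, ⟨K₀, hK₀K, hfg, hK₀, rfl⟩, hmax⟩ :=
    set_has_maximal_iff_noetherian.2 (inferInstance : IsNoetherian Rᵐᵒᵖ (Fin n → R)) S hS
  suffices K ≤ K₀ by rwa [le_antisymm this hK₀K]
  intro x hx
  have hF := isRightHopfModule_colCoaction hρA hh
  obtain ⟨m, w, h', hh', hw, hwK, hxw⟩ := hF.exists_fg_subcomodule hK {x} (by simpa using hx)
  obtain ⟨c, rfl⟩ := hxw x (by simp)
  have hrange : (LinearMap.range (columnMap (A := A) w)).FG := by
    have := finite_op_pi A m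
    exact Module.Finite.iff_fg.1 inferInstance
  have hK₁ := hK₀.sup (isSubcomodule_range_columnMap hF hw)
  have hle : columnSpanMap θ (K₀ ⊔ LinearMap.range (columnMap w)) ≤ columnSpanMap θ K₀ := by
    by_contra hnot
    exact hmax _ ⟨_, sup_le hK₀K hwK, hfg.sup hrange, hK₁, rfl⟩
      (lt_of_le_not_ge (columnSpanMap_mono θ le_sup_left) hnot)
  exact le_of_columnSpanMap_le hρA hsimple θ hh hK₀ hK₁ (hproj hh hK₀ hfg) hle
    (Submodule.mem_sup_right ⟨_, rfl⟩)

end FiniteGeneration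

/-! ### Flatness and projectivity of Hopf modules -/

section HopfModules

variable {k H : Type*} [Field k] [Ring H] [HopfAlgebra k H]
variable {A : Type uA} [Ring A] [Algebra k A] {ρA : A →ₐ[k] A ⊗[k] H}
variable {M : Type uM} [AddCommGroup M] [Module k M] [Module Aᵐᵒᵖ M] [IsScalarTower k Aᵐᵒᵖ M]
  {ρM : M →ₗ[k] M ⊗[k] H}

/-- A Hopf module is a directed colimit of quotients of free Hopf modules by finitely generated
Hopf submodules. -/
theorem IsRightHopfModule.isRightFlat (hρA : IsRightComoduleAlgebra ρA)
    (hproj : ∀ {n : ℕ} {h : Fin n → Fin n → H} {K : Submodule Aᵐᵒᵖ (Fin n → A)},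
      IsComultiplicative k h → IsSubcomodule (colCoaction ρA h) (K.restrictScalars k) → K.FG →
      Module.Projective Aᵐᵒᵖ ((Fin n → A) ⧸ K))
    (hM : IsRightHopfModule ρA ρM) : IsRightFlat.{uA, uM, uN} A M := by
  classical
  refine isRightFlat_of_factorization.{uA, uM, uN, uA} fun S κ hκ => ?_
  have htop : IsSubcomodule ρM ((⊤ : Submodule Aᵐᵒᵖ M).restrictScalars k) :=
    isSubcomodule_iff_slice.2 fun _ _ _ => trivial
  -- Cover the generators in `S` and those occurring in the relations `κ`.
  obtain ⟨m, w, h, hh, hw, -, hSw⟩ := hM.exists_fg_subcomodule htop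
    (S ∪ κ.biUnion Finsupp.support) fun _ _ => trivial
  have hlift : ∀ x : M, ∃ v : Fin m → A, x ∈ S ∪ κ.biUnion Finsupp.support →
      columnMap w v = x := by
    intro x
    by_cases hx : x ∈ S ∪ κ.biUnion Finsupp.support
    · obtain ⟨c, hc⟩ := hSw x hx
      exact ⟨_, fun _ => hc⟩
    · exact ⟨0, fun h => absurd h hx⟩
  choose v hv using hlift
  let α₀ : (M →₀ Aᵐᵒᵖ) →ₗ[Aᵐᵒᵖ] (Fin m → A) := Finsupp.linearCombination Aᵐᵒᵖ v
  have hα₀ : ∀ z ∈ κ, α₀ z ∈ LinearMap.ker (columnMap (A := A) w) := by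
    intro z hz
    rw [LinearMap.mem_ker, ← hκ z hz, Finsupp.linearCombination_apply,
      Finsupp.linearCombination_apply, Finsupp.sum, Finsupp.sum, map_sum]
    refine Finset.sum_congr rfl fun x hx => ?_
    rw [map_smul, hv x (Finset.mem_union_right _ (Finset.mem_biUnion.2 ⟨z, hz, hx⟩))]
    rfl
  have hF := isRightHopfModule_colCoaction hρA hh
  obtain ⟨r, w', h', hh', hw', hw'ker, hκw'⟩ := hF.exists_fg_subcomodule
    (isSubcomodule_ker_columnMap hM hw) (κ.image α₀) (by simpa using hα₀)
  let K₀ := LinearMap.range (columnMap (A := A) w')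
  have hfg : K₀.FG := by
    have := finite_op_pi A r
    exact Module.Finite.iff_fg.1 inferInstance
  refine ⟨(Fin m → A) ⧸ K₀, inferInstance, inferInstance,
    hproj hh (isSubcomodule_range_columnMap hF hw') hfg, K₀.mkQ ∘ₗ α₀,
    K₀.liftQ (columnMap w) hw'ker, fun z hz => ?_, fun x hx => ?_⟩
  · obtain ⟨c, hc⟩ := hκw' _ (Finset.mem_image_of_mem _ hz)
    exact (Submodule.Quotient.mk_eq_zero _).2 ⟨_, hc⟩
  · rw [LinearMap.comp_apply, Submodule.mkQ_apply, Submodule.liftQ_apply]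
    simp only [α₀, Finsupp.linearCombination_single, one_smul]
    exact hv x (Finset.mem_union_left _ hx)

/-- If all quotients of free Hopf modules `A ^ n` by Hopf submodules are projective, then so are
all Hopf modules. By Zorn's lemma, a free cover has a maximal submodule which maps isomorphically
onto a Hopf submodule. -/
theorem IsRightHopfModule.projective
    (hproj : ∀ {n : ℕ} {h : Fin n → Fin n → H} {K : Submodule Aᵐᵒᵖ (Fin n → A)},
      IsComultiplicative k h → IsSubcomodule (colCoaction ρA h) (K.restrictScalars k) →
      Module.Projective Aᵐᵒᵖ ((Fin n → A) ⧸ K))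
    (hM : IsRightHopfModule ρA ρM) : Module.Projective Aᵐᵒᵖ M := by
  let π : (M →₀ Aᵐᵒᵖ) →ₗ[Aᵐᵒᵖ] M := Finsupp.linearCombination Aᵐᵒᵖ id
  have hπ : ∀ x, π (Finsupp.single x 1) = x := fun x => by simp [π]
  let S : Set (Submodule Aᵐᵒᵖ (M →₀ Aᵐᵒᵖ)) :=
    {G | (∀ z ∈ G, π z = 0 → z = 0) ∧ IsSubcomodule ρM ((G.map π).restrictScalars k)}
  obtain ⟨G, hG⟩ : ∃ G, Maximal (· ∈ S) G := by
    refine zorn_le₀ S fun c hcS hc => ?_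
    rcases c.eq_empty_or_nonempty with rfl | hne
    · refine ⟨⊥, ⟨fun z hz _ => hz, ?_⟩, by simp⟩
      rw [Submodule.map_bot]
      exact isSubcomodule_bot ρM
    · have hmem : ∀ z, z ∈ sSup c ↔ ∃ G ∈ c, z ∈ G := fun z =>
        Submodule.mem_sSup_of_directed hne hc.directedOn
      refine ⟨sSup c, ⟨fun z hz => ?_, ?_⟩, fun G hG => le_sSup hG⟩
      · obtain ⟨G, hGc, hzG⟩ := (hmem z).1 hz
        exact (hcS hGc).1 z hzG
      · rw [isSubcomodule_iff_slice]
        rintro _ ⟨z, hz, rfl⟩ χ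
        obtain ⟨G, hGc, hzG⟩ := (hmem z).1 hz
        exact Submodule.map_mono (le_sSup hGc) (isSubcomodule_iff_slice.1 (hcS hGc).2 _
          (Submodule.mem_map_of_mem hzG) χ)
  obtain ⟨⟨hGinj, hGstab⟩, hmax⟩ := hG
  have hGtop : ∀ x, ∃ z ∈ G, π z = x := by
    intro x
    have htop : IsSubcomodule ρM ((⊤ : Submodule Aᵐᵒᵖ M).restrictScalars k) :=
      isSubcomodule_iff_slice.2 fun _ _ _ => trivial
    obtain ⟨m, w, h, hh, hw, -, hxw⟩ := hM.exists_fg_subcomodule htop {x} fun _ _ => trivial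
    obtain ⟨c, hc⟩ := hxw x (by simp)
    let K : Submodule Aᵐᵒᵖ (Fin m → A) := (G.map π).comap (columnMap w)
    have := hproj hh (isSubcomodule_comap_columnMap hM hw hGstab)
    obtain ⟨τ, hτ⟩ := Module.projective_lifting_property K.mkQ LinearMap.id K.mkQ_surjective
    have hτ' : ∀ q, K.mkQ (τ q) = q := fun q => LinearMap.congr_fun hτ q
    let T : (Fin m → A) →ₗ[Aᵐᵒᵖ] (M →₀ Aᵐᵒᵖ) := columnMap fun j => Finsupp.single (w j) 1
    have hT : ∀ y, π (T y) = columnMap w y := by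
      intro y
      simp only [T, columnMap_apply, map_sum, map_smul, hπ]
    let G' := G ⊔ LinearMap.range (T ∘ₗ τ)
    have hmap : G'.map π = G.map π ⊔ LinearMap.range (columnMap (A := A) w) := by
      apply le_antisymm
      · rw [Submodule.map_sup]
        refine sup_le_sup le_rfl ?_
        rintro _ ⟨_, ⟨q, rfl⟩, rfl⟩
        exact ⟨τ q, (hT _).symm⟩
      · refine sup_le (Submodule.map_mono le_sup_left) ?_
        rintro _ ⟨y, rfl⟩
        have h1 : y - τ (K.mkQ y) ∈ K := by
          rw [← Submodule.Quotient.mk_eq_zero, ← Submodule.mkQ_apply, map_sub, hτ', sub_self]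
        have h2 : columnMap w y =
            columnMap w (y - τ (K.mkQ y)) + columnMap w (τ (K.mkQ y)) := by
          rw [← map_add, sub_add_cancel]
        rw [h2]
        refine Submodule.add_mem _ (Submodule.map_mono le_sup_left h1) ?_
        rw [← hT]
        exact Submodule.mem_map_of_mem (Submodule.mem_sup_right ⟨_, rfl⟩)
    have hG' : G' ∈ S := by
      refine ⟨fun z hz hz0 => ?_, ?_⟩
      · obtain ⟨γ, hγ, _, ⟨q, rfl⟩, rfl⟩ := Submodule.mem_sup.1 hz
        rw [LinearMap.comp_apply] at hz0 ⊢
        rw [map_add, hT] at hz0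
        have hq : τ q ∈ K := by
          change columnMap w (τ q) ∈ G.map π
          rw [eq_neg_of_add_eq_zero_right hz0]
          exact Submodule.neg_mem _ (Submodule.mem_map_of_mem hγ)
        have hq0 : q = 0 := by
          rw [← hτ' q, Submodule.mkQ_apply, Submodule.Quotient.mk_eq_zero]
          exact hq
        rw [hq0, map_zero, map_zero, add_zero] at hz0 ⊢
        exact hGinj γ hγ hz0
      · rw [hmap]
        exact hGstab.sup (isSubcomodule_range_columnMap hM hw)
    have hx : x ∈ G'.map π := by
      rw [hmap]
      exact Submodule.mem_sup_right ⟨_, hc⟩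
    obtain ⟨z, hz, rfl⟩ := hx
    exact ⟨z, hmax hG' le_sup_left hz, rfl⟩
  have hbij : Function.Bijective (π ∘ₗ G.subtype) := by
    constructor
    · intro y z hyz
      have := hGinj (y - z : G) (y - z : G).2 (by simpa [sub_eq_zero] using hyz)
      exact sub_eq_zero.1 (Subtype.ext this)
    · intro x
      obtain ⟨z, hz, hzx⟩ := hGtop x
      exact ⟨⟨z, hz⟩, hzx⟩
  let e := LinearEquiv.ofBijective (π ∘ₗ G.subtype) hbij
  refine Module.Projective.of_split (G.subtype ∘ₗ e.symm.toLinearMap) π ?_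
  exact LinearMap.ext fun x => e.apply_symm_apply x

end HopfModules

theorem theorem4p4
    {k : Type uk} {H : Type uH} [Field k] [Ring H] [HopfAlgebra k H]
    {A : Type uA} [Ring A] [Algebra k A]
    (ρA : A →ₐ[k] A ⊗[k] H) (hρA : IsRightComoduleAlgebra ρA)
    (hsimple : IsSimpleLeftHopfModule ρA ρA.toLinearMap)
    {Q : Type uQ} [Ring Q] (ι : A →+* Q)
    (hQ : IsClassicalQuotientRing ι) (hreg : IsVonNeumannRegularRing Q)
    (hcoh : IsRightCoherentRing A)
    (hpd : ∀ (V : Type uA) [AddCommGroup V] [Module Aᵐᵒᵖ V], Module.FinitePresentation Aᵐᵒᵖ V →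
      CategoryTheory.projectiveDimension (ModuleCat.of Aᵐᵒᵖ V) < ⊤) :
    (∀ (M : Type uM) [AddCommGroup M] [Module k M] [Module Aᵐᵒᵖ M] [IsScalarTower k Aᵐᵒᵖ M]
      (ρM : M →ₗ[k] M ⊗[k] H), IsRightHopfModule ρA ρM → IsRightFlat.{uA, uM, uN} A M) ∧
    (∀ (R : Type uR) [Ring R] [Nontrivial R] [IsArtinian Rᵐᵒᵖ R] (_ : A →+* R),
      ∀ (M : Type uM) [AddCommGroup M] [Module k M] [Module Aᵐᵒᵖ M] [IsScalarTower k Aᵐᵒᵖ M]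
        (ρM : M →ₗ[k] M ⊗[k] H), IsRightHopfModule ρA ρM → Module.Projective Aᵐᵒᵖ M) := by
  refine ⟨fun M _ _ _ _ ρM hM => hM.isRightFlat hρA fun hh hK hfg =>
    projective_quotient_of_fg hρA hsimple hQ hreg hcoh hpd hh hK hfg, ?_⟩
  intro R _ _ _ θ M _ _ _ _ ρM hM
  have : IsArtinianRing Rᵐᵒᵖ :=
    isArtinian_of_linearEquiv (MulOpposite.opLinearEquiv Rᵐᵒᵖ (M := R))
  have : IsNoetherian Rᵐᵒᵖ R :=
    isNoetherian_of_linearEquiv (MulOpposite.opLinearEquiv Rᵐᵒᵖ (M := R)).symm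
  refine hM.projective fun hh hK =>
    projective_quotient_of_fg hρA hsimple hQ hreg hcoh hpd hh hK ?_
  exact fg_of_isSubcomodule hρA hsimple
    (fun hh hK hfg => projective_quotient_of_fg hρA hsimple hQ hreg hcoh hpd hh hK hfg) θ hh hK
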